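/- For functions $f,g\colon[n]^d\to[0,1]$ let $L_1(f,g)=\frac1{n^d}\sum_{x\in[n]^d}|f(x)-g(x)|$, and let $L_1(f,\mathcal M)=\inf_{g\in\mathcal M}L_1(f,g)$, where $\mathcal M$ is the set of monotone functions $g\colon[n]^d\to[0,1]$ (that is, $g(x)\le g(y)$ whenever $x\le y$ coordinatewise). **Theorem.** There is a randomized non-adaptive algorithm which, for all integers $n,d\ge1$ and all $0\le\varepsilon_1<\varepsilon_2\le1$, given $n,d,\varepsilon_1,\varepsilon_2$ and query access to any $f\colon[n]^d\to[0,1]$, makes at most $q(n,d,\varepsilon_1,\varepsilon_2)$ queries to $f$, the queried points depending only on the internal randomness of the algorithm and not on the answers, and outputs ACCEPT or REJECT such that * if $L_1(f,\mathcal M)\le\varepsilon_1$, it outputs ACCEPT with probability at least $2/3$; * if $L_1(f,\mathcal M)\ge\varepsilon_2$, it outputs REJECT with probability at least $2/3$. Here * $q(n,d,\varepsilon_1,\varepsilon_2)\le\widetilde O\!\left(\frac1{(\varepsilon_2-\varepsilon_1)^2}\left(\frac{5d}{\varepsilon_2-\varepsilon_1}\right)^d\right)$ for all $0\le\varepsilon_1<\varepsilon_2\le1$,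 and * $q(n,d,\varepsilon_1,\varepsilon_2)\le2^{\widetilde O\left(\sqrt d/(\varepsilon_2-3\varepsilon_1)^2\right)}$ whenever moreover $0\le3\varepsilon_1<\varepsilon_2\le1$, where $\widetilde O(x)$ stands for a quantity that is at most $C\,x\,\log_2^{c}(x+2)$ for constants $C,c\ge0$ independent of $n,d,\varepsilon_1,\varepsilon_2$. -/

import Mathlib

open scoped unitInterval ENNReal

/-- The normalized `L₁` distance `(1 / |X|) * ∑ x, |f x - g x|` of `f, g : X → [0,1]`. -/
noncomputable def l1Dist {X : Type} [Fintype X] (f g : X → I) : ℝ :=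
  (∑ x, |(f x : ℝ) - (g x : ℝ)|) / (Fintype.card X : ℝ)

/-- The `L₁` distance of `f` to a (nonempty) property `P` of functions `X → [0,1]`,
the infimum over `g ∈ P` of the distance of `f` to `g`. -/
noncomputable def l1DistTo {X : Type} [Fintype X] (f : X → I) (P : Set (X → I)) : ℝ :=
  sInf (l1Dist f '' P)

/-- A deterministic non-adaptive query algorithm for functions `X → Y`: it fixes the points to be
queried in advance (repetitions are counted), and accepts (`true`) or rejects (`false`) on the
basis of the list of answers. -/
structure NonadaptiveAlg (X Y : Type) where
  /-- number of queries made -/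
  numQueries : ℕ
  /-- the queried points -/
  point : Fin numQueries → X
  /-- the verdict, given the answers -/
  verdict : (Fin numQueries → Y) → Bool

/-- The output of the algorithm with oracle access to `f`. -/
def NonadaptiveAlg.run {X Y : Type} (A : NonadaptiveAlg X Y) (f : X → Y) : Bool :=
  A.verdict (fun i => f (A.point i))

/-- A randomized non-adaptive query algorithm: the internal randomness determines the queries and
the verdict function, i.e. it is a probability distribution on deterministic algorithms. -/
abbrev RandNonadaptiveAlg (X Y : Type) := PMF (NonadaptiveAlg X Y)

/-- The probability, over the internal randomness, that the output on `f` is `b`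
(`true` is ACCEPT, `false` is REJECT). -/
noncomputable def RandNonadaptiveAlg.probOutput {X Y : Type} (T : RandNonadaptiveAlg X Y)
    (f : X → Y) (b : Bool) : ℝ≥0∞ :=
  (PMF.map (fun A => A.run f) T) b

/-- `T`, which takes the parameters `ε₁, ε₂` as input, is a non-adaptive `q`-query tolerant
`L₁`-tester for the property `P` of functions `X → [0,1]`. -/
def IsTolerantL1Tester {X : Type} [Fintype X] (P : Set (X → I)) (q : ℝ → ℝ → ℕ)
    (T : ℝ → ℝ → RandNonadaptiveAlg X I) : Prop :=
  ∀ ε₁ ε₂ : ℝ, 0 ≤ ε₁ → ε₁ < ε₂ → ε₂ ≤ 1 →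
    (∀ A ∈ (T ε₁ ε₂).support, A.numQueries ≤ q ε₁ ε₂) ∧
    ∀ f : X → I,
      (l1DistTo f P ≤ ε₁ → 2 / 3 ≤ (T ε₁ ε₂).probOutput f true) ∧
      (ε₂ ≤ l1DistTo f P → 2 / 3 ≤ (T ε₁ ε₂).probOutput f false)

/-- `C * x * log₂(x + 2) ^ c`. A quantity is `Õ(x)`, uniformly over all parameters, if it is at
most `softBound C c x` with constants `C, c`; the shift by `2` keeps the logarithm at least `1`
for `x ≥ 0`. -/
noncomputable def softBound (C : ℝ) (c : ℕ) (x : ℝ) : ℝ :=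
  C * x * (Real.logb 2 (x + 2)) ^ c

/-! Tolerant testing is reduced to covering the monotone functions in `L₁`. If finitely many
functions, log-many in the query bound, approximate all monotone functions to within a small
multiple of the gap `e`, then choose a monotone representative near each useful centre, sample
uniform points, and accept when some representative has small empirical distance to `f`. A Chernoff
bound for one representative gives completeness, and a union bound over all of them gives soundness.
About `log |cover| / e ^ 2` samples suffice (`exists_tester_of_cover`).

Two covers are used. For both, a monotone function is first replaced by one constant on blocks of a
grid with about `d / δ` blocks per side, at `L₁` cost `δ` (`exists_block_approx`). Rounding the
block values gives the first cover, whose logarithm is about `(5 d / e) ^ d`.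

For the second, the block function is truncated to its low-degree part in the orthogonal
decomposition generated by the coordinate averages. A monotone function has total influence at most
`√d` (`sum_influence_le`), so degree of order `√d / e ^ 2` leaves small `L₂`, hence `L₁`, error. The
truncation is a signed combination of averages in each of which fewer than `D` coordinates remain
free, so it is determined by a value for each sparse pattern of block indices
(`exists_lowPart_cover`). The coefficients have total size at most `3 ^ d`; a finer rounding grid
absorbs this, at only logarithmic cost in the query count. -/

/-! ### Coordinate averages as orthogonal projections -/

section Averaging

variable {ι α : Type} [Fintype ι] [DecidableEq ι] [Fintype α]

/-- Swapping the value of the `i`-th coordinate with an independent one preserves sums. -/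
lemma sum_sum_update_swap (i : ι) (K : (ι → α) → α → ℝ) :
    ∑ x, ∑ a, K (Function.update x i a) (x i) = ∑ x, ∑ a, K x a := by
  rw [← Fintype.sum_prod_type' (f := fun (x : ι → α) a => K (Function.update x i a) (x i)),
    ← Fintype.sum_prod_type' (f := K)]
  refine Fintype.sum_bijective (fun p : (ι → α) × α => (Function.update p.1 i p.2, p.1 i))
    (Function.Involutive.bijective ?_) _ _ (fun _ => rfl)
  rintro ⟨x, a⟩
  simp

lemma sum_sum_update (i : ι) (H : (ι → α) → ℝ) :
    ∑ x, ∑ a, H (Function.update x i a) = Fintype.card α * ∑ x, H x := by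
  rw [sum_sum_update_swap i (fun x _ => H x)]
  simp [Finset.mul_sum]

/-- Averaging over the `i`-th coordinate. -/
noncomputable def coordAvg {ι α : Type} [DecidableEq ι] [Fintype α] (i : ι) :
    ((ι → α) → ℝ) →ₗ[ℝ] ((ι → α) → ℝ) where
  toFun f x := (∑ a, f (Function.update x i a)) / Fintype.card α
  map_add' f g := by
    ext x
    simp [Finset.sum_add_distrib, add_div]
  map_smul' c f := by
    ext x
    simp [← Finset.mul_sum, mul_div_assoc]

lemma coordAvg_apply {ι α : Type} [DecidableEq ι] [Fintype α] (i : ι) (f : (ι → α) → ℝ)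
    (x : ι → α) :
    coordAvg i f x = (∑ a, f (Function.update x i a)) / Fintype.card α := rfl

lemma coordAvg_update {ι α : Type} [DecidableEq ι] [Fintype α] (i : ι) (f : (ι → α) → ℝ)
    (x : ι → α) (a : α) : coordAvg i f (Function.update x i a) = coordAvg i f x := by
  simp [coordAvg_apply]

lemma coordAvg_comm {ι α : Type} [DecidableEq ι] [Fintype α] (i j : ι) (f : (ι → α) → ℝ) :
    coordAvg i (coordAvg j f) = coordAvg j (coordAvg i f) := by
  rcases eq_or_ne i j with rfl | hij
  · rfl
  ext x
  simp only [coordAvg_apply, ← Finset.sum_div]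
  rw [Finset.sum_comm]
  simp only [Function.update_comm hij]

lemma coordAvg_idem {ι α : Type} [DecidableEq ι] [Fintype α] [Nonempty α] (i : ι)
    (f : (ι → α) → ℝ) : coordAvg i (coordAvg i f) = coordAvg i f := by
  ext x
  rw [coordAvg_apply]
  simp [coordAvg_update]

/-- The average `coordAvg i u` is constant along lines in direction `i`, so summing over such a line
replaces `w` by its average: the projection is self-adjoint. -/
lemma sum_coordAvg_mul [Nonempty α] (i : ι) (u w : (ι → α) → ℝ) :
    ∑ x, coordAvg i u x * w x = ∑ x, coordAvg i u x * coordAvg i w x := by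
  have hc : (Fintype.card α : ℝ) ≠ 0 := by simp
  have h := sum_sum_update i (fun x => coordAvg i u x * w x)
  simp only [coordAvg_update, ← Finset.mul_sum] at h
  simp only [coordAvg_apply i w, mul_div_assoc']
  rw [← Finset.sum_div, h, mul_div_cancel_left₀ _ hc]

lemma sum_sq_coordAvg_add_sub [Nonempty α] (i : ι) (u v : (ι → α) → ℝ) :
    ∑ x, (coordAvg i u + (v - coordAvg i v)) x ^ 2 =
      ∑ x, coordAvg i u x ^ 2 + ∑ x, (v - coordAvg i v) x ^ 2 := by
  have h := sum_coordAvg_mul i u (v - coordAvg i v)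
  rw [map_sub, coordAvg_idem, sub_self] at h
  simp only [Pi.zero_apply, mul_zero, Finset.sum_const_zero] at h
  rw [← Finset.sum_add_distrib, ← sub_eq_zero, ← Finset.sum_sub_distrib]
  rw [← mul_zero 2, ← h, Finset.mul_sum]
  refine Finset.sum_congr rfl fun x _ => ?_
  simp only [Pi.add_apply]
  ring

end Averaging

/-! ### Truncation by degree for commuting projections -/

section LowPart

variable {ι V : Type} [AddCommGroup V] [Module ℝ V]

/-- For commuting projections `E i`, the component of a vector of degree less than `D`, where the
range of `1 - E i` is regarded as having degree one in `i`. -/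
noncomputable def lowPart (E : ι → V →ₗ[ℝ] V) : List ι → ℕ → V →ₗ[ℝ] V
  | [], 0 => 0
  | [], _ + 1 => LinearMap.id
  | _ :: _, 0 => 0
  | i :: l, D + 1 => E i ∘ₗ lowPart E l (D + 1) + (LinearMap.id - E i) ∘ₗ lowPart E l D

lemma lowPart_zero (E : ι → V →ₗ[ℝ] V) (l : List ι) : lowPart E l 0 = 0 := by
  cases l <;> rfl

lemma lowPart_cons_succ (E : ι → V →ₗ[ℝ] V) (i : ι) (l : List ι) (D : ℕ) (f : V) :
    lowPart E (i :: l) (D + 1) f =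
      E i (lowPart E l (D + 1) f) + (lowPart E l D f - E i (lowPart E l D f)) := rfl

lemma lowPart_comm (E : ι → V →ₗ[ℝ] V) (hE : ∀ i j f, E i (E j f) = E j (E i f)) (j : ι)
    (l : List ι) (D : ℕ) (f : V) : lowPart E l D (E j f) = E j (lowPart E l D f) := by
  induction l generalizing D with
  | nil => cases D <;> simp [lowPart]
  | cons i l ih =>
    cases D with
    | zero => simp [lowPart_zero]
    | succ D => simp only [lowPart_cons_succ, ih, map_add, map_sub, hE j i]

lemma sub_lowPart_cons_succ (E : ι → V →ₗ[ℝ] V) (i : ι) (l : List ι) (D : ℕ) (f : V) :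
    f - lowPart E (i :: l) (D + 1) f =
      E i (f - lowPart E l (D + 1) f) + ((f - lowPart E l D f) - E i (f - lowPart E l D f)) := by
  rw [lowPart_cons_succ]
  simp only [map_sub]
  abel

/-- `N` plays the role of a squared norm, and `hN` is Pythagoras for the splitting by `E i`.
Removing low-degree components cannot increase it. -/
lemma seminorm_sub_lowPart_le (E : ι → V →ₗ[ℝ] V) (hE : ∀ i j f, E i (E j f) = E j (E i f))
    (N : V → ℝ) (h0 : ∀ f, 0 ≤ N f) (hz : N 0 = 0)
    (hN : ∀ i u v, N (E i u + (v - E i v)) = N (E i u) + N (v - E i v))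
    (l : List ι) (D : ℕ) (f : V) : N (f - lowPart E l D f) ≤ N f := by
  induction l generalizing D f with
  | nil => cases D <;> simp [lowPart, hz, h0]
  | cons i l ih =>
    cases D with
    | zero => simp [lowPart_zero]
    | succ D =>
      rw [sub_lowPart_cons_succ E, hN]
      have h1 := ih (D + 1) (E i f)
      have h2 := ih D (f - E i f)
      have h3 := hN i f f
      rw [lowPart_comm E hE, ← map_sub] at h1
      rw [map_sub, lowPart_comm E hE] at h2
      rw [add_sub_cancel] at h3
      have h4 : f - E i f - (lowPart E l D f - E i (lowPart E l D f)) =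
          (f - lowPart E l D f) - E i (f - lowPart E l D f) := by
        rw [map_sub]; abel
      rw [h4] at h2
      linarith

/-- Markov's inequality for the degree: the influences on the right count a component of degree `k`
exactly `k` times, and only components of degree at least `D` survive on the left. -/
lemma mul_sub_lowPart_le (E : ι → V →ₗ[ℝ] V) (hE : ∀ i j f, E i (E j f) = E j (E i f))
    (N : V → ℝ) (h0 : ∀ f, 0 ≤ N f) (hz : N 0 = 0)
    (hN : ∀ i u v, N (E i u + (v - E i v)) = N (E i u) + N (v - E i v))
    (l : List ι) (D : ℕ) (f : V) :
    D * N (f - lowPart E l D f) ≤ (l.map fun i => N (f - E i f)).sum := by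
  induction l generalizing D f with
  | nil => cases D <;> simp [lowPart, hz]
  | cons i l ih =>
    cases D with
    | zero =>
      simp only [Nat.cast_zero, zero_mul]
      refine List.sum_nonneg fun a ha => ?_
      obtain ⟨j, -, rfl⟩ := List.mem_map.1 ha
      exact h0 _
    | succ D =>
      rw [sub_lowPart_cons_succ E, hN, List.map_cons, List.sum_cons]
      have h1 := ih (D + 1) (E i f)
      have h2 := ih D (f - E i f)
      -- The part `f - E i f` already has degree one in `i`. Induction supplies the factor `D` from
      -- the other coordinates, and this bound supplies the remaining one of `D + 1`.
      have h5 := seminorm_sub_lowPart_le E hE N h0 hz hN l D (f - E i f)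
      rw [lowPart_comm E hE, ← map_sub] at h1
      rw [map_sub, lowPart_comm E hE] at h2 h5
      have h4 : f - E i f - (lowPart E l D f - E i (lowPart E l D f)) =
          (f - lowPart E l D f) - E i (f - lowPart E l D f) := by
        rw [map_sub]; abel
      rw [h4] at h2 h5
      -- Every other influence splits by Pythagoras in direction `i`, since the projections commute.
      have h6 : (l.map fun j => N (f - E j f)).sum =
          (l.map fun j => N (E i f - E j (E i f))).sum +
            (l.map fun j => N (f - E i f - E j (f - E i f))).sum := by
        rw [← List.sum_map_add]
        congr 1
        refine List.map_congr_left fun j _ => ?_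
        have h7 := hN i (f - E j f) (f - E j f)
        rw [add_sub_cancel] at h7
        rw [h7, map_sub, hE i j, map_sub (E j)]
        congr 2
        abel
      rw [h6]
      push_cast at h1 ⊢
      linarith

/-- The coefficients and the products of projections in the expansion of `lowPart`. -/
def lowPartTerms {ι : Type} : List ι → ℕ → List (ℤ × List ι)
  | [], 0 => []
  | [], _ + 1 => [(1, [])]
  | _ :: _, 0 => []
  | i :: l, D + 1 =>
    (lowPartTerms l (D + 1)).map (fun p => (p.1, i :: p.2)) ++
      (lowPartTerms l D ++ (lowPartTerms l D).map (fun p => (-p.1, i :: p.2)))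

lemma lowPart_eq_sum (E : ι → V →ₗ[ℝ] V) (l : List ι) (D : ℕ) (f : V) :
    lowPart E l D f =
      ((lowPartTerms l D).map fun p => (p.1 : ℝ) • p.2.foldr (fun i => E i) f).sum := by
  induction l generalizing D with
  | nil => cases D <;> simp [lowPart, lowPartTerms]
  | cons i l ih =>
    cases D with
    | zero => simp [lowPart_zero, lowPartTerms]
    | succ D =>
      rw [lowPart_cons_succ, ih, ih]
      simp only [lowPartTerms, List.map_append, List.sum_append, List.map_map, map_list_sum,
        Function.comp_def, map_smul, List.foldr_cons, Int.cast_neg, neg_smul,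
        sub_eq_add_neg]
      congr 2
      induction lowPartTerms l D with
      | nil => simp
      | cons p t ih => rw [List.map_cons, List.sum_cons, List.map_cons, List.sum_cons, neg_add, ih]

/-- Each coordinate contributes three recursive copies: `E i` of one truncation, another truncation,
and minus `E i` of the latter. -/
lemma lowPartTerms_abs_sum_le (l : List ι) (D : ℕ) :
    ((lowPartTerms l D).map fun p => |(p.1 : ℝ)|).sum ≤ 3 ^ l.length := by
  induction l generalizing D with
  | nil => cases D <;> simp [lowPartTerms]
  | cons i l ih =>
    cases D with
    | zero =>
      simp only [lowPartTerms, List.map_nil, List.sum_nil]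
      positivity
    | succ D =>
      have h1 := ih (D + 1)
      have h2 := ih D
      simp only [lowPartTerms, List.map_append, List.sum_append, List.map_map,
        Function.comp_def, Int.cast_neg, abs_neg, List.length_cons, pow_succ]
      linarith

/-- A term averages over the coordinates in `p.2`; those left free are the only ones its value can
depend on, and there are fewer than `D`. -/
lemma lowPartTerms_length_filter_lt [DecidableEq ι] (l : List ι) (D : ℕ) (p : ℤ × List ι)
    (hp : p ∈ lowPartTerms l D) : (l.filter (fun i => i ∉ p.2)).length < D := by
  induction l generalizing D p with
  | nil => cases D <;> simp_all [lowPartTerms]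
  | cons i l ih =>
    have key : ∀ (q : List ι), ((i :: l).filter (fun j => j ∉ i :: q)).length ≤
        (l.filter (fun j => j ∉ q)).length := by
      intro q
      rw [List.filter_cons_of_neg (by simp)]
      refine (List.monotone_filter_right l ?_).length_le
      intro a ha
      simp at ha ⊢
      tauto
    cases D with
    | zero => simp [lowPartTerms] at hp
    | succ D =>
      simp only [lowPartTerms, List.mem_append, List.mem_map] at hp
      rcases hp with ⟨q, hq, rfl⟩ | hp | ⟨q, hq, rfl⟩
      · exact (key q.2).trans_lt (ih _ _ hq)
      · have := ih _ _ hp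
        rw [List.filter_cons]
        split_ifs
        · simpa using this
        · omega
      · exact ((key q.2).trans_lt (ih _ _ hq)).trans (Nat.lt_succ_self D)

end LowPart

/-! ### Total influence of monotone functions -/

section Influence

/-- The number of elements below `a` minus the number of elements above `a`. -/
noncomputable def rankBalance {n : ℕ} (a : Fin n) : ℝ :=
  ∑ b : Fin n, ((if b < a then 1 else 0) - (if a < b then 1 else 0))

lemma abs_rankBalance_le {n : ℕ} (a : Fin n) : |rankBalance a| ≤ n := by
  refine (Finset.abs_sum_le_sum_abs _ _).trans ?_
  calc _ ≤ ∑ _b : Fin n, (1 : ℝ) := Finset.sum_le_sum fun b _ => by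
        split_ifs <;> norm_num
    _ = n := by simp

lemma sum_mul_rankBalance {n : ℕ} (G : Fin n → ℝ) :
    2 * ∑ a, G a * rankBalance a = ∑ a, ∑ b, (G a - G b) *
      ((if b < a then 1 else 0) - (if a < b then 1 else 0)) := by
  simp only [rankBalance, Finset.mul_sum, sub_mul, Finset.sum_sub_distrib, two_mul]
  rw [Finset.sum_comm (f := fun a b => G b * _)]
  simp only [mul_sub, Finset.sum_sub_distrib, Finset.mul_sum, Finset.sum_add_distrib]
  ring

lemma sum_rankBalance {n : ℕ} : ∑ a : Fin n, rankBalance a = 0 := by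
  have := sum_mul_rankBalance (n := n) (fun _ => 1)
  simpa using this

/-- The variance of a monotone function on a chain is controlled by its correlation with the
rank. -/
lemma sum_sq_sub_avg_le {n : ℕ} (hn : 0 < n) (G : Fin n → ℝ) (hG : Monotone G)
    (h0 : ∀ a, 0 ≤ G a) (h1 : ∀ a, G a ≤ 1) :
    ∑ a, (G a - (∑ b, G b) / n) ^ 2 ≤ (∑ a, G a * rankBalance a) / n := by
  have hn' : (0 : ℝ) < n := by exact_mod_cast hn
  rw [le_div_iff₀ hn']
  have e1 : (∑ a, (G a - (∑ b, G b) / n) ^ 2) * n = n * ∑ a, G a ^ 2 - (∑ b, G b) ^ 2 := by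
    have : ∀ a, (G a - (∑ b, G b) / n) ^ 2 =
        G a ^ 2 - 2 * ((∑ b, G b) / n) * G a + ((∑ b, G b) / n) ^ 2 := fun a => by ring
    simp only [this, Finset.sum_add_distrib, Finset.sum_sub_distrib, ← Finset.mul_sum,
      Finset.sum_const, Finset.card_univ, Fintype.card_fin, nsmul_eq_mul]
    field_simp
    ring
  have e2 : ∑ a, ∑ b, (G a - G b) ^ 2 = 2 * (n * ∑ a, G a ^ 2 - (∑ b, G b) ^ 2) := by
    have : ∀ a b, (G a - G b) ^ 2 = G a ^ 2 - 2 * (G a * G b) + G b ^ 2 := fun a b => by ring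
    simp only [this, Finset.sum_add_distrib, Finset.sum_sub_distrib, ← Finset.mul_sum,
      Finset.sum_const, Finset.card_univ, Fintype.card_fin, nsmul_eq_mul, ← Finset.sum_mul]
    ring
  -- Values in `[0,1]` give `(G a - G b) ^ 2 ≤ |G a - G b|`, and monotonicity identifies the sign of
  -- the difference with the order of `a` and `b`.
  have e3 : ∑ a, ∑ b, (G a - G b) ^ 2 ≤ 2 * ∑ a, G a * rankBalance a := by
    rw [sum_mul_rankBalance]
    refine Finset.sum_le_sum fun a _ => Finset.sum_le_sum fun b _ => ?_
    have ha0 := h0 a; have ha1 := h1 a; have hb0 := h0 b; have hb1 := h1 b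
    rcases lt_trichotomy a b with h | rfl | h
    · have := hG h.le
      rw [if_neg h.asymm, if_pos h]
      nlinarith
    · simp
    · have := hG h.le
      rw [if_neg h.asymm, if_pos h]
      nlinarith
  linarith

variable {d n : ℕ}

lemma sum_sq_sub_coordAvg_le (hn : 0 < n) (f : (Fin d → Fin n) → ℝ) (hf : Monotone f)
    (h0 : ∀ x, 0 ≤ f x) (h1 : ∀ x, f x ≤ 1) (i : Fin d) :
    ∑ x, (f - coordAvg i f) x ^ 2 ≤ (∑ x, f x * rankBalance (x i)) / n := by
  have hn' : (0 : ℝ) < n := by exact_mod_cast hn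
  have hL := sum_sum_update i (fun x => (f - coordAvg i f) x ^ 2)
  have hR := sum_sum_update i (fun x => f x * rankBalance (x i))
  simp only [Fintype.card_fin] at hL hR
  have key : (n : ℝ) * ∑ x, (f - coordAvg i f) x ^ 2 ≤
      (n * ∑ x, f x * rankBalance (x i)) / n := by
    rw [← hL, ← hR, Finset.sum_div]
    refine Finset.sum_le_sum fun x _ => ?_
    have := sum_sq_sub_avg_le hn (fun a => f (Function.update x i a))
      (fun a b hab => hf (update_le_update_iff.2 ⟨hab, fun _ _ => le_rfl⟩))
      (fun _ => h0 _) (fun _ => h1 _)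
    simpa [coordAvg_apply] using this
  rw [mul_div_assoc] at key
  exact le_of_mul_le_mul_left key hn'

/-- The rank balances of distinct coordinates are independent and centred, so the cross terms
vanish. This is what turns `d` into `√d` in the influence bound. -/
lemma sum_sq_sum_rankBalance_le (hn : 0 < n) :
    ∑ x : Fin d → Fin n, (∑ i, rankBalance (x i)) ^ 2 ≤ d * (n : ℝ) ^ 2 * (n : ℝ) ^ d := by
  have hn' : (0 : ℝ) < n := by exact_mod_cast hn
  have hoff : ∀ i j : Fin d, i ≠ j →
      ∑ x : Fin d → Fin n, rankBalance (x i) * rankBalance (x j) = 0 := by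
    intro i j hij
    have h := sum_sum_update i (fun x : Fin d → Fin n => rankBalance (x i) * rankBalance (x j))
    simp only [Function.update_self, Function.update_of_ne hij.symm, ← Finset.sum_mul,
      sum_rankBalance, zero_mul, Finset.sum_const_zero, Fintype.card_fin] at h
    exact (mul_eq_zero.1 h.symm).resolve_left hn'.ne'
  have hdiag : ∀ i : Fin d, ∑ x : Fin d → Fin n, rankBalance (x i) * rankBalance (x i) ≤
      (n : ℝ) ^ 2 * (n : ℝ) ^ d := by
    intro i
    calc _ ≤ ∑ _x : Fin d → Fin n, (n : ℝ) ^ 2 := Finset.sum_le_sum fun x _ => by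
          rw [← sq, ← sq_abs]
          exact pow_le_pow_left₀ (abs_nonneg _) (abs_rankBalance_le _) 2
      _ = _ := by simp [mul_comm]
  calc ∑ x : Fin d → Fin n, (∑ i, rankBalance (x i)) ^ 2
      = ∑ i, ∑ j, ∑ x : Fin d → Fin n, rankBalance (x i) * rankBalance (x j) := by
        simp only [sq, Finset.sum_mul_sum]
        rw [Finset.sum_comm]
        exact Finset.sum_congr rfl fun i _ => Finset.sum_comm
    _ = ∑ i, ∑ x : Fin d → Fin n, rankBalance (x i) * rankBalance (x i) :=
        Finset.sum_congr rfl fun i _ =>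
          Finset.sum_eq_single i (fun j _ hj => hoff i j hj.symm) (by simp)
    _ ≤ ∑ _i : Fin d, (n : ℝ) ^ 2 * (n : ℝ) ^ d := Finset.sum_le_sum fun i _ => hdiag i
    _ = _ := by simp; ring

/-- The total influence of a monotone function is at most `√d`. -/
lemma sum_influence_le (hn : 0 < n) (f : (Fin d → Fin n) → ℝ) (hf : Monotone f)
    (h0 : ∀ x, 0 ≤ f x) (h1 : ∀ x, f x ≤ 1) :
    ∑ i, ∑ x, (f - coordAvg i f) x ^ 2 ≤ Real.sqrt d * (n : ℝ) ^ d := by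
  have hn' : (0 : ℝ) < n := by exact_mod_cast hn
  -- Cauchy–Schwarz between `f`, bounded by one, and the sum of the rank balances.
  have hcs : (∑ x, f x * ∑ i, rankBalance (x i)) ≤ Real.sqrt d * (n : ℝ) ^ d * n := by
    refine le_of_sq_le_sq ?_ (by positivity)
    refine (Finset.sum_mul_sq_le_sq_mul_sq _ _ _).trans ?_
    have hfs : ∑ x, f x ^ 2 ≤ (n : ℝ) ^ d := by
      calc _ ≤ ∑ _x : Fin d → Fin n, (1 : ℝ) := Finset.sum_le_sum fun x _ => by
            nlinarith [h0 x, h1 x]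
        _ = _ := by simp
    have := mul_le_mul hfs (sum_sq_sum_rankBalance_le (d := d) hn)
      (Finset.sum_nonneg fun _ _ => sq_nonneg _) (by positivity)
    refine this.trans (le_of_eq ?_)
    rw [mul_pow, mul_pow, Real.sq_sqrt (Nat.cast_nonneg d)]
    ring
  calc _ ≤ ∑ i, (∑ x, f x * rankBalance (x i)) / n :=
        Finset.sum_le_sum fun i _ => sum_sq_sub_coordAvg_le hn f hf h0 h1 i
    _ = (∑ x, f x * ∑ i, rankBalance (x i)) / n := by
        rw [← Finset.sum_div, Finset.sum_comm]
        simp only [Finset.mul_sum]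
    _ ≤ _ := by
        rw [div_le_iff₀ hn']
        exact hcs

/-- A monotone function is close in `L₁` to its part of degree less than `D`. -/
lemma sum_abs_sub_lowPart_le (hn : 0 < n) (f : (Fin d → Fin n) → ℝ) (hf : Monotone f)
    (h0 : ∀ x, 0 ≤ f x) (h1 : ∀ x, f x ≤ 1) (D : ℕ) (δ : ℝ) (hδ : 0 ≤ δ)
    (hDpos : 0 < D) (hD : Real.sqrt d ≤ D * δ ^ 2) :
    ∑ x, |f x - lowPart coordAvg (List.finRange d) D f x| ≤ δ * (n : ℝ) ^ d := by
  have : Nonempty (Fin n) := ⟨⟨0, hn⟩⟩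
  have hD' : (0 : ℝ) < D := by exact_mod_cast hDpos
  have h := mul_sub_lowPart_le (coordAvg (ι := Fin d) (α := Fin n)) coordAvg_comm
    (fun g => ∑ x, g x ^ 2) (fun g => Finset.sum_nonneg fun _ _ => sq_nonneg _) (by simp)
    sum_sq_coordAvg_add_sub (List.finRange d) D f
  rw [← List.ofFn_eq_map, List.sum_ofFn] at h
  have h2 := h.trans (sum_influence_le hn f hf h0 h1)
  have h3 : ∑ x, (f - lowPart coordAvg (List.finRange d) D f) x ^ 2 ≤ δ ^ 2 * (n : ℝ) ^ d := by
    have : (D : ℝ) * ∑ x, (f - lowPart coordAvg (List.finRange d) D f) x ^ 2 ≤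
        D * (δ ^ 2 * (n : ℝ) ^ d) := by
      refine h2.trans ?_
      rw [← mul_assoc]
      gcongr
    exact le_of_mul_le_mul_left this hD'
  refine le_of_sq_le_sq ?_ (by positivity)
  have h4 := Finset.sum_mul_sq_le_sq_mul_sq Finset.univ
    (fun x => |f x - lowPart coordAvg (List.finRange d) D f x|) (fun _ => (1 : ℝ))
  simp only [mul_one, sq_abs, one_pow, Finset.sum_const, Finset.card_univ, Fintype.card_fun,
    Fintype.card_fin, nsmul_eq_mul, Nat.cast_pow] at h4
  refine h4.trans ?_
  calc _ ≤ δ ^ 2 * (n : ℝ) ^ d * (n : ℝ) ^ d := by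
        gcongr
        exact h3
    _ = _ := by ring

end Influence

/-! ### Rounding to a coarse grid -/

section Coarsening

variable {d n : ℕ}

/-- Rounding down to a multiple of `b`. -/
def roundDown (b : ℕ) {n : ℕ} (a : Fin n) : Fin n :=
  ⟨b * (a / b), (Nat.mul_div_le _ _).trans_lt a.2⟩

lemma roundDown_mono (b : ℕ) {n : ℕ} : Monotone (roundDown b : Fin n → Fin n) := by
  intro x y hxy
  exact Nat.mul_le_mul_left b (Nat.div_le_div_right hxy)

lemma roundDown_le (b : ℕ) {n : ℕ} (a : Fin n) : roundDown b a ≤ a :=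
  Nat.mul_div_le _ _

/-- Lengthening the shift by one adds a telescoping sum, worth at most one. Truncated subtraction
makes the terms near zero vanish. -/
lemma sum_sub_shift_le (t n : ℕ) (G : ℕ → ℝ) (h0 : ∀ a, 0 ≤ G a) (h1 : ∀ a, G a ≤ 1) :
    ∑ a ∈ Finset.range n, (G a - G (a - t)) ≤ t := by
  induction t with
  | zero => simp
  | succ t ih =>
    have hs : ∑ a ∈ Finset.range n, (G (a - t) - G (a - (t + 1))) ≤ 1 := by
      cases n with
      | zero => simp
      | succ m =>
        have : ∀ m : ℕ, ∑ a ∈ Finset.range (m + 1), (G (a - t) - G (a - (t + 1))) =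
            G (m - t) - G 0 := by
          intro m
          induction m with
          | zero => simp
          | succ m ih =>
            rw [Finset.sum_range_succ, ih]
            rw [show m + 1 - (t + 1) = m - t by omega]
            ring
        rw [this]
        linarith [h1 (m - t), h0 0]
    have : ∑ a ∈ Finset.range n, (G a - G (a - (t + 1))) =
        ∑ a ∈ Finset.range n, (G a - G (a - t)) +
          ∑ a ∈ Finset.range n, (G (a - t) - G (a - (t + 1))) := by
      rw [← Finset.sum_add_distrib]
      exact Finset.sum_congr rfl fun a _ => by ring
    rw [this]
    push_cast
    linarith

lemma sum_sub_roundDown_le {b : ℕ} (hb : 0 < b) (G : Fin n → ℝ) (hG : Monotone G)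
    (h0 : ∀ a, 0 ≤ G a) (h1 : ∀ a, G a ≤ 1) :
    ∑ a, (G a - G (roundDown b a)) ≤ (b - 1 : ℕ) := by
  rcases Nat.eq_zero_or_pos n with rfl | hn
  · simp
  have := sum_sub_shift_le (b - 1) n
    (fun a => if h : a < n then G ⟨a, h⟩ else 0)
    (fun a => by split_ifs <;> simp [h0])
    (fun a => by split_ifs <;> simp [h1])
  refine le_trans ?_ this
  rw [← Fin.sum_univ_eq_sum_range (fun a => (if h : a < n then G ⟨a, h⟩ else 0) -
    (if h : a - (b - 1) < n then G ⟨a - (b - 1), h⟩ else 0))]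
  refine Finset.sum_le_sum fun a _ => ?_
  have ha := a.2
  rw [dif_pos a.2, dif_pos (by omega)]
  -- Rounding down moves a point by at most `b - 1`, so monotonicity bounds the loss by that of a
  -- uniform shift.
  have : (⟨a - (b - 1), by omega⟩ : Fin n) ≤ roundDown b a := by
    rw [Fin.le_def]
    simp only [roundDown]
    have h2 := Nat.div_add_mod (a : ℕ) b
    have h3 := Nat.mod_lt (a : ℕ) hb
    omega
  linarith [hG this]

/-- Coordinates are rounded one at a time; each step is the one-dimensional bound on every line in
that direction. -/
lemma sum_sub_comp_roundDown_le {b : ℕ} (hb : 0 < b) (f : (Fin d → Fin n) → ℝ)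
    (hf : Monotone f) (h0 : ∀ x, 0 ≤ f x) (h1 : ∀ x, f x ≤ 1) :
    n * ∑ x, (f x - f (fun i => roundDown b (x i))) ≤ d * (b - 1 : ℕ) * (n : ℝ) ^ d := by
  have key : ∀ S : Finset (Fin d),
      n * ∑ x, (f x - f (S.piecewise (fun i => roundDown b (x i)) x)) ≤
        S.card * (b - 1 : ℕ) * (n : ℝ) ^ d := by
    intro S
    induction S using Finset.induction_on with
    | empty => simp
    | insert i S hi ih =>
      have hstep : n * ∑ x, (f (S.piecewise (fun j => roundDown b (x j)) x) -
          f ((insert i S).piecewise (fun j => roundDown b (x j)) x)) ≤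
          (b - 1 : ℕ) * (n : ℝ) ^ d := by
        have h := sum_sum_update i (fun x : Fin d → Fin n =>
          (f (S.piecewise (fun j => roundDown b (x j)) x) -
            f ((insert i S).piecewise (fun j => roundDown b (x j)) x)))
        rw [Fintype.card_fin] at h
        rw [← h]
        calc _ ≤ ∑ _x : Fin d → Fin n, ((b - 1 : ℕ) : ℝ) := ?_
          _ = _ := by simp [mul_comm]
        refine Finset.sum_le_sum fun x _ => ?_
        have hu : ∀ a, S.piecewise (fun j => roundDown b (Function.update x i a j))
            (Function.update x i a) =
            Function.update (S.piecewise (fun j => roundDown b (x j)) x) i a := by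
          intro a
          ext j
          rcases eq_or_ne j i with rfl | hj
          · simp [hi]
          · by_cases hjS : j ∈ S <;> simp [hjS, hj]
        have hline := sum_sub_roundDown_le hb
          (fun a => f (Function.update (S.piecewise (fun j => roundDown b (x j)) x) i a))
          (fun a c hac => hf (update_le_update_iff.2 ⟨hac, fun _ _ => le_rfl⟩))
          (fun _ => h0 _) (fun _ => h1 _)
        refine le_trans (le_of_eq ?_) hline
        refine Finset.sum_congr rfl fun a _ => ?_
        rw [Finset.piecewise_insert, hu]
        simp
      rw [Finset.card_insert_of_notMem hi]
      have : ∑ x, (f x - f ((insert i S).piecewise (fun j => roundDown b (x j)) x)) =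
          ∑ x, (f x - f (S.piecewise (fun j => roundDown b (x j)) x)) +
          ∑ x, (f (S.piecewise (fun j => roundDown b (x j)) x) -
            f ((insert i S).piecewise (fun j => roundDown b (x j)) x)) := by
        rw [← Finset.sum_add_distrib]
        exact Finset.sum_congr rfl fun x _ => by ring
      rw [this]
      push_cast
      linarith
  simpa using key Finset.univ

/-- A monotone function is close in `L₁` to a function which is constant on the blocks of a
coarse grid. -/
lemma exists_block_approx (hn : 0 < n) (hd : 0 < d) {δ : ℝ} (hδ : 0 < δ) :
    ∃ b k : ℕ, 0 < b ∧ (∀ a : Fin n, (a : ℕ) / b < k) ∧ (k : ℝ) ≤ d / δ + 1 ∧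
      ∀ f : (Fin d → Fin n) → ℝ, Monotone f → (∀ x, 0 ≤ f x) → (∀ x, f x ≤ 1) →
        ∑ x, |f x - f (fun i => roundDown b (x i))| ≤ δ * (n : ℝ) ^ d := by
  have hn' : (0 : ℝ) < n := by exact_mod_cast hn
  have hd' : (0 : ℝ) < d := by exact_mod_cast hd
  -- Both `b - 1 ≤ δ * n / d`, for the error, and `δ * n / d < b`, for the number of blocks, are
  -- needed. When `δ * n < d` this gives `b = 1`, with no rounding.
  set b := ⌊δ * n / d⌋₊ + 1 with hbdef
  have hb : 0 < b := Nat.succ_pos _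
  have hb' : (0 : ℝ) < b := by exact_mod_cast hb
  refine ⟨b, ⌈(n : ℝ) / b⌉₊, hb, ?_, ?_, ?_⟩
  · intro a
    rw [Nat.lt_ceil, lt_div_iff₀ hb']
    have h1 : (a : ℕ) / b * b < n := (Nat.div_mul_le_self _ _).trans_lt a.2
    exact_mod_cast h1
  · refine (Nat.ceil_lt_add_one (by positivity)).le.trans ?_
    gcongr ?_ + 1
    rw [div_le_div_iff₀ hb' hδ]
    have : δ * n / d < b := by
      rw [hbdef]; push_cast; exact Nat.lt_floor_add_one _
    rw [div_lt_iff₀ hd'] at this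
    linarith
  · intro f hf h0 h1
    have h := sum_sub_comp_roundDown_le hb f hf h0 h1
    have e : ∑ x, |f x - f (fun i => roundDown b (x i))| =
        ∑ x, (f x - f (fun i => roundDown b (x i))) :=
      Finset.sum_congr rfl fun x _ =>
        abs_of_nonneg (sub_nonneg.2 (hf fun i => roundDown_le b (x i)))
    rw [e]
    have hfl : ((b - 1 : ℕ) : ℝ) ≤ δ * n / d := by
      rw [hbdef, Nat.add_sub_cancel]
      exact Nat.floor_le (by positivity)
    have h2 : d * (b - 1 : ℕ) * (n : ℝ) ^ d ≤ n * (δ * (n : ℝ) ^ d) := by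
      calc d * ((b - 1 : ℕ) : ℝ) * (n : ℝ) ^ d ≤ d * (δ * n / d) * (n : ℝ) ^ d := by gcongr
        _ = _ := by field_simp
    exact le_of_mul_le_mul_left (h.trans h2) hn'

end Coarsening

/-! ### Finite covers of the monotone functions -/

section Cover

/-- Makes a sublist of a duplicate-free list recoverable from its set of members, hence from a
pattern. -/
lemma List.filter_mem_eq_of_sublist {ι : Type} [DecidableEq ι] {l u : List ι} (hl : l.Nodup)
    (hu : u.Sublist l) : l.filter (fun i => i ∈ u) = u := by
  induction hu with
  | slnil => rfl
  | cons a h ih =>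
    rw [List.nodup_cons] at hl
    rw [List.filter_cons_of_neg (by simpa using fun ha => hl.1 (h.subset ha)), ih hl.2]
  | cons_cons a h ih =>
    rw [List.nodup_cons] at hl
    rw [List.filter_cons_of_pos (by simp)]
    congr 1
    conv_rhs => rw [← ih hl.2]
    refine List.filter_congr fun i hi => ?_
    have : i ≠ a := fun h => hl.1 (h ▸ hi)
    simp [this]

lemma lowPartTerms_sublist {ι : Type} (l : List ι) (D : ℕ) (p : ℤ × List ι)
    (hp : p ∈ lowPartTerms l D) : p.2.Sublist l := by
  induction l generalizing D p with
  | nil => cases D <;> simp_all [lowPartTerms]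
  | cons i l ih =>
    cases D with
    | zero => simp [lowPartTerms] at hp
    | succ D =>
      simp only [lowPartTerms, List.mem_append, List.mem_map] at hp
      rcases hp with ⟨q, hq, rfl⟩ | hp | ⟨q, hq, rfl⟩
      · exact (ih _ _ hq).cons_cons i
      · exact (ih _ _ hp).cons i
      · exact (ih _ _ hq).cons_cons i

/-- Rounding of a number in `[0,1]` to the grid `{0, 1/r, …, r/r}`. -/
lemma exists_abs_sub_grid_le (r : ℕ) (hr : 0 < r) (y : ℝ) (h0 : 0 ≤ y) (h1 : y ≤ 1) :
    ∃ a : Fin (r + 1), |y - (a : ℕ) / r| ≤ 1 / r := by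
  have hr' : (0 : ℝ) < r := by exact_mod_cast hr
  have hf := Nat.floor_le (mul_nonneg h0 hr'.le)
  have hf' := (Nat.lt_floor_add_one (y * r)).le
  refine ⟨⟨⌊y * r⌋₊, ?_⟩, ?_⟩
  · rw [Nat.lt_succ_iff]
    refine Nat.floor_le_of_le ?_
    nlinarith
  · have e : y - (⌊y * r⌋₊ : ℝ) / r = (y * r - ⌊y * r⌋₊) / r := by
      field_simp
    simp only
    rw [e, abs_of_nonneg (div_nonneg (by linarith) hr'.le)]
    gcongr
    linarith

variable {d n : ℕ}

/-- Monotone functions are approximated by functions that are constant on blocks, with values in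
a grid. -/
lemma exists_block_cover (hn : 0 < n) (hd : 0 < d) {δ : ℝ} (hδ : 0 < δ) (r : ℕ) (hr : 0 < r) :
    ∃ k : ℕ, (k : ℝ) ≤ d / δ + 1 ∧
      ∃ p : ((Fin d → Fin k) → Fin (r + 1)) → (Fin d → Fin n) → ℝ,
        ∀ f : (Fin d → Fin n) → ℝ, Monotone f → (∀ x, 0 ≤ f x) → (∀ x, f x ≤ 1) →
          ∃ θ, ∑ x, |f x - p θ x| ≤ (δ + 1 / r) * (n : ℝ) ^ d := by
  obtain ⟨b, k, hb, hk, hkd, happ⟩ := exists_block_approx hn hd hδ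
  refine ⟨k, hkd, fun θ x => ((θ fun i => ⟨x i / b, hk _⟩ : Fin (r + 1)) : ℕ) / r, ?_⟩
  intro f hf h0 h1
  choose w hw using fun x => exists_abs_sub_grid_le r hr (f x) (h0 x) (h1 x)
  -- The rounded value at the lower corner of block `z`. The default `0` is never read, as the
  -- corner of the block of an actual point lies in the grid.
  refine ⟨fun z => if h : ∀ i, b * (z i : ℕ) < n then w fun i => ⟨b * z i, h i⟩ else 0, ?_⟩
  calc _ ≤ ∑ x, (|f x - f (fun i => roundDown b (x i))| + 1 / r) := ?_
    _ ≤ _ := by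
      rw [Finset.sum_add_distrib, add_mul]
      refine add_le_add (happ f hf h0 h1) (le_of_eq ?_)
      simp [mul_comm]
  refine Finset.sum_le_sum fun x _ => ?_
  have hx : ∀ i, b * ((x i : ℕ) / b) < n := fun i => (roundDown b (x i)).2
  simp only [dif_pos hx]
  exact (abs_sub_le _ (f fun i => roundDown b (x i)) _).trans (add_le_add le_rfl (hw _))

/-- The coordinates outside `u` of a point, up to `β`. -/
def patternOutside {ι α κ : Type} [DecidableEq ι] (β : α → κ) (u : List ι) (x : ι → α) :
    ι → Option κ :=
  fun i => if i ∈ u then none else some (β (x i))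

lemma patternOutside_eq_iff {ι α κ : Type} [DecidableEq ι] (β : α → κ) (u : List ι)
    (x y : ι → α) :
    patternOutside β u x = patternOutside β u y ↔ ∀ i, i ∉ u → β (x i) = β (y i) := by
  rw [funext_iff]
  refine forall_congr' fun i => ?_
  by_cases hi : i ∈ u <;> simp [patternOutside, hi]

/-- Patterns fixing at most `D` coordinates. -/
abbrev SparsePattern (ι κ : Type) [Fintype ι] (D : ℕ) : Type :=
  {z : ι → Option κ // (Finset.univ.filter fun i => (z i).isSome).card ≤ D}

/-- A pattern is encoded by the list of its fixed coordinates with their values, padded by `none` to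
length `D`. -/
lemma card_sparsePattern_le (ι κ : Type) [Fintype ι] [DecidableEq ι] [Fintype κ] (D : ℕ) :
    Nat.card (SparsePattern ι κ D) ≤ (Fintype.card ι * Fintype.card κ + 1) ^ D := by
  classical
  let e : SparsePattern ι κ D → Fin D → Option (ι × κ) := fun z j =>
    ((Finset.univ.filter fun i => (z.1 i).isSome).toList.filterMap
      fun i => (z.1 i).map fun a => (i, a))[(j : ℕ)]?
  have he : Function.Injective e := by
    intro z w hzw
    have hlen : ∀ z : SparsePattern ι κ D,
        ((Finset.univ.filter fun i => (z.1 i).isSome).toList.filterMap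
          fun i => (z.1 i).map fun a => (i, a)).length ≤ D := fun z =>
      (List.length_filterMap_le _ _).trans (by simpa using z.2)
    have hl : ((Finset.univ.filter fun i => (z.1 i).isSome).toList.filterMap
          fun i => (z.1 i).map fun a => (i, a)) =
        ((Finset.univ.filter fun i => (w.1 i).isSome).toList.filterMap
          fun i => (w.1 i).map fun a => (i, a)) := by
      refine List.ext_getElem? fun j => ?_
      by_cases hj : j < D
      · exact congrFun hzw ⟨j, hj⟩
      · rw [List.getElem?_eq_none ((hlen z).trans (not_lt.1 hj)),
          List.getElem?_eq_none ((hlen w).trans (not_lt.1 hj))]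
    have hmem : ∀ (z : SparsePattern ι κ D) (i : ι) (a : κ),
        (i, a) ∈ ((Finset.univ.filter fun i => (z.1 i).isSome).toList.filterMap
          fun i => (z.1 i).map fun a => (i, a)) ↔ z.1 i = some a := by
      intro z i a
      simp only [List.mem_filterMap, Finset.mem_toList, Finset.mem_filter, Finset.mem_univ,
        true_and, Option.map_eq_some_iff, Prod.mk.injEq]
      constructor
      · rintro ⟨j, -, c, hc, rfl, rfl⟩
        exact hc
      · intro h
        exact ⟨i, by simp [h], a, h, rfl, rfl⟩
    refine Subtype.ext (funext fun i => Option.ext fun a => ?_)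
    rw [← hmem z, ← hmem w, hl]
  calc Nat.card (SparsePattern ι κ D) ≤ Nat.card (Fin D → Option (ι × κ)) :=
        Nat.card_le_card_of_injective e he
    _ = _ := by simp

lemma foldr_coordAvg_mem_Icc {ι α : Type} [DecidableEq ι] [Fintype α] [Nonempty α] (u : List ι)
    (f : (ι → α) → ℝ) (hf : ∀ x, f x ∈ Set.Icc (0 : ℝ) 1) (x : ι → α) :
    u.foldr (fun i => coordAvg i) f x ∈ Set.Icc (0 : ℝ) 1 := by
  induction u generalizing x with
  | nil => exact hf x
  | cons i u ih =>
    rw [List.foldr_cons, coordAvg_apply]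
    have hc : (0 : ℝ) < Fintype.card α := by exact_mod_cast Fintype.card_pos
    refine ⟨div_nonneg (Finset.sum_nonneg fun a _ => (ih _).1) hc.le, ?_⟩
    rw [div_le_one hc]
    refine (Finset.sum_le_sum fun a _ => (ih _).2).trans ?_
    simp

/-- Averaging over a coordinate erases the dependence on it, so only the blocks of the free
coordinates matter. -/
lemma foldr_coordAvg_congr {ι α κ : Type} [DecidableEq ι] [Fintype α] (β : α → κ) (u : List ι)
    (f : (ι → α) → ℝ) (hf : ∀ x y, (∀ i, β (x i) = β (y i)) → f x = f y) (x y : ι → α)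
    (hxy : ∀ i, i ∉ u → β (x i) = β (y i)) :
    u.foldr (fun i => coordAvg i) f x = u.foldr (fun i => coordAvg i) f y := by
  induction u generalizing x y with
  | nil => exact hf x y fun i => hxy i (by simp)
  | cons i u ih =>
    rw [List.foldr_cons, coordAvg_apply, coordAvg_apply]
    congr 1
    refine Finset.sum_congr rfl fun a _ => ih _ _ fun j hj => ?_
    rcases eq_or_ne j i with rfl | hji
    · simp
    · simp only [Function.update_of_ne hji]
      exact hxy j (by simp [hj, hji])

lemma abs_list_sum_le {γ : Type} (l : List γ) (f : γ → ℝ) :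
    |(l.map f).sum| ≤ (l.map fun a => |f a|).sum := by
  induction l with
  | nil => simp
  | cons a l ih =>
    simp only [List.map_cons, List.sum_cons]
    exact (abs_add_le _ _).trans (by linarith)

/-- The low-degree part of a block function, with rounded block averages. -/
lemma exists_abs_lowPart_sub_le {κ : Type} (hn : 0 < n) (β : Fin n → κ) (D r : ℕ) (hr : 0 < r) :
    ∃ p : (SparsePattern (Fin d) κ D → Fin (r + 1)) → (Fin d → Fin n) → ℝ,
      ∀ f : (Fin d → Fin n) → ℝ, (∀ x, f x ∈ Set.Icc (0 : ℝ) 1) →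
        (∀ x y, (∀ i, β (x i) = β (y i)) → f x = f y) →
        ∃ θ, ∀ x, |lowPart coordAvg (List.finRange d) D f x - p θ x| ≤ 3 ^ d * (1 / r) := by
  classical
  have : Nonempty (Fin n) := ⟨⟨0, hn⟩⟩
  let val : (SparsePattern (Fin d) κ D → Fin (r + 1)) → (Fin d → Option κ) → ℝ := fun θ z =>
    if h : (Finset.univ.filter fun i => (z i).isSome).card ≤ D then
      ((θ ⟨z, h⟩ : ℕ) : ℝ) / r else 0
  refine ⟨fun θ x => ((lowPartTerms (List.finRange d) D).map fun p =>
    (p.1 : ℝ) * val θ (patternOutside β p.2 x)).sum, ?_⟩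
  intro f hf hβ
  -- The pattern determines both the set of averaged coordinates and the value of the average, so
  -- one rounded number per pattern is consistent.
  have hF : ∀ z : Fin d → Option κ, ∃ a : Fin (r + 1), ∀ (u : List (Fin d)) (x : Fin d → Fin n),
      u.Sublist (List.finRange d) → patternOutside β u x = z →
        |u.foldr (fun i => coordAvg i) f x - (a : ℕ) / r| ≤ 1 / r := by
    intro z
    by_cases hz : ∃ (u : List (Fin d)) (x : Fin d → Fin n),
        u.Sublist (List.finRange d) ∧ patternOutside β u x = z
    · obtain ⟨u, x, hu, rfl⟩ := hz
      obtain ⟨a, ha⟩ := exists_abs_sub_grid_le r hr (u.foldr (fun i => coordAvg i) f x)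
        (foldr_coordAvg_mem_Icc u f hf x).1 (foldr_coordAvg_mem_Icc u f hf x).2
      refine ⟨a, fun v y hv hvy => ?_⟩
      obtain rfl : v = u := by
        rw [← List.filter_mem_eq_of_sublist (List.nodup_finRange d) hv,
          ← List.filter_mem_eq_of_sublist (List.nodup_finRange d) hu]
        refine List.filter_congr fun i _ => ?_
        have := congrFun hvy i
        by_cases h1 : i ∈ v <;> by_cases h2 : i ∈ u <;> simp_all [patternOutside]
      rw [foldr_coordAvg_congr β v f hβ y x ((patternOutside_eq_iff β v y x).1 hvy)]
      exact ha
    · exact ⟨0, fun u x hu h => absurd ⟨u, x, hu, h⟩ hz⟩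
  choose w hw using hF
  refine ⟨fun z => w z.1, fun x => ?_⟩
  have hval : ∀ p ∈ lowPartTerms (List.finRange d) D,
      val (fun z => w z.1) (patternOutside β p.2 x) =
        ((w (patternOutside β p.2 x) : ℕ) : ℝ) / r := by
    intro p hp
    refine dif_pos ?_
    refine le_trans (le_of_eq ?_) (lowPartTerms_length_filter_lt _ _ p hp).le
    rw [← List.toFinset_card_of_nodup ((List.nodup_finRange d).filter _)]
    congr 1
    ext i
    by_cases hi : i ∈ p.2 <;> simp [patternOutside, hi]
  rw [lowPart_eq_sum]
  have happly : ((lowPartTerms (List.finRange d) D).map fun p =>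
      (p.1 : ℝ) • p.2.foldr (fun i => ⇑(coordAvg i)) f).sum x =
      ((lowPartTerms (List.finRange d) D).map fun p =>
        (p.1 : ℝ) * p.2.foldr (fun i => ⇑(coordAvg i)) f x).sum := by
    induction lowPartTerms (List.finRange d) D with
    | nil => simp
    | cons p t ih => simp [ih]
  rw [happly, sub_eq_add_neg, ← neg_one_mul, ← List.sum_map_mul_left, ← List.sum_map_add]
  refine (abs_list_sum_le _ _).trans ?_
  calc _ ≤ ((lowPartTerms (List.finRange d) D).map fun p => |(p.1 : ℝ)| * (1 / r)).sum := by
        refine List.sum_le_sum fun p hp => ?_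
        rw [hval p hp, neg_one_mul, ← sub_eq_add_neg, ← mul_sub, abs_mul]
        gcongr
        exact hw _ _ _ (lowPartTerms_sublist _ _ p hp) rfl
    _ ≤ _ := by
        rw [List.sum_map_mul_right]
        gcongr
        simpa using lowPartTerms_abs_sum_le (List.finRange d) D

/-- Monotone functions are approximated by functions determined by few rounded block averages. -/
lemma exists_lowPart_cover (hn : 0 < n) (hd : 0 < d) {δ δ' : ℝ} (hδ : 0 < δ) (hδ' : 0 ≤ δ')
    (D : ℕ) (hDpos : 0 < D) (hD : Real.sqrt d ≤ D * δ' ^ 2) (r : ℕ) (hr : 0 < r) :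
    ∃ k : ℕ, (k : ℝ) ≤ d / δ + 1 ∧
      ∃ p : (SparsePattern (Fin d) (Fin k) D → Fin (r + 1)) → (Fin d → Fin n) → ℝ,
        ∀ f : (Fin d → Fin n) → ℝ, Monotone f → (∀ x, 0 ≤ f x) → (∀ x, f x ≤ 1) →
          ∃ θ, ∑ x, |f x - p θ x| ≤ (δ + δ' + 3 ^ d * (1 / r)) * (n : ℝ) ^ d := by
  obtain ⟨b, k, hb, hk, hkd, happ⟩ := exists_block_approx hn hd hδ
  obtain ⟨p, hp⟩ := exists_abs_lowPart_sub_le (d := d) hn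
    (fun a : Fin n => (⟨a / b, hk a⟩ : Fin k)) D r hr
  refine ⟨k, hkd, p, fun f hf h0 h1 => ?_⟩
  set h : (Fin d → Fin n) → ℝ := fun x => f fun i => roundDown b (x i) with hh
  have hmono : Monotone h := fun x y hxy => hf fun i => roundDown_mono b (hxy i)
  obtain ⟨θ, hθ⟩ := hp h (fun x => ⟨h0 _, h1 _⟩) (fun x y hxy => by
    simp only [hh]
    congr 1
    ext i
    have := hxy i
    simp only [Fin.mk.injEq] at this
    simp [roundDown, this])
  refine ⟨θ, ?_⟩
  have hlow := sum_abs_sub_lowPart_le hn h hmono (fun _ => h0 _) (fun _ => h1 _) D δ' hδ' hDpos hD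
  calc _ ≤ ∑ x, (|f x - h x| + |h x - lowPart coordAvg (List.finRange d) D h x| +
        3 ^ d * (1 / r)) := by
        refine Finset.sum_le_sum fun x _ => ?_
        have a1 := abs_sub_le (f x) (h x) (p θ x)
        have a2 := abs_sub_le (h x) (lowPart coordAvg (List.finRange d) D h x) (p θ x)
        linarith [hθ x]
    _ ≤ _ := by
        rw [Finset.sum_add_distrib, Finset.sum_add_distrib, add_mul, add_mul]
        refine add_le_add (add_le_add (happ f hf h0 h1) hlow) (le_of_eq ?_)
        simp [mul_comm]

end Cover

/-! ### Uniform sampling and testers from covers -/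

section Sampling

/-- Chernoff bound for the average of `m` uniform independent samples, in counting form. -/
lemma card_deviation_le {X : Type} [Fintype X] [Nonempty X] (φ : X → ℝ)
    (hφ : ∀ x, |φ x| ≤ 1) (h0 : ∑ x, φ x = 0) (m : ℕ) {t : ℝ} (ht0 : 0 ≤ t) (ht : t ≤ 1) :
    (Nat.card {s : Fin m → X // m * t ≤ ∑ i, φ (s i)} : ℝ) ≤
      (Fintype.card X : ℝ) ^ m * Real.exp (-(t ^ 2 / 4 * m)) := by
  classical
  -- Minimises the exponent `c ^ 2 * m - c * m * t`.
  set c := t / 2 with hc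
  have h1 : ∑ x, Real.exp (c * φ x) ≤ Fintype.card X * Real.exp (c ^ 2) := by
    have hx : ∀ x, Real.exp (c * φ x) ≤ 1 + c * φ x + c ^ 2 := by
      intro x
      have hb : |c * φ x| ≤ 1 := by
        rw [abs_mul, abs_of_nonneg (by positivity)]
        nlinarith [hφ x, abs_nonneg (φ x)]
      have h2 := (abs_le.1 (Real.abs_exp_sub_one_sub_id_le hb)).2
      have h3 : (c * φ x) ^ 2 ≤ c ^ 2 := by
        rw [mul_pow, ← sq_abs (φ x)]
        have : |φ x| ^ 2 ≤ 1 := pow_le_one₀ (abs_nonneg _) (hφ x)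
        nlinarith [sq_nonneg c]
      linarith
    calc _ ≤ ∑ x, (1 + c * φ x + c ^ 2) := Finset.sum_le_sum fun x _ => hx x
      _ = Fintype.card X * (c ^ 2 + 1) := by
        rw [Finset.sum_add_distrib, Finset.sum_add_distrib, ← Finset.mul_sum, h0]
        simp
        ring
      _ ≤ _ := by gcongr; exact Real.add_one_le_exp _
  have h2 : ∑ s : Fin m → X, Real.exp (c * ∑ i, φ (s i)) ≤
      (Fintype.card X : ℝ) ^ m * Real.exp (c ^ 2 * m) := by
    have : ∑ s : Fin m → X, Real.exp (c * ∑ i, φ (s i)) = (∑ x, Real.exp (c * φ x)) ^ m := by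
      rw [Finset.sum_pow', Fintype.piFinset_univ]
      simp [Finset.mul_sum, Real.exp_sum]
    rw [this]
    calc _ ≤ (Fintype.card X * Real.exp (c ^ 2)) ^ m :=
          pow_le_pow_left₀ (Finset.sum_nonneg fun _ _ => (Real.exp_pos _).le) h1 m
      _ = _ := by rw [mul_pow, ← Real.exp_nat_mul, mul_comm (m : ℝ)]
  have h3 : (Nat.card {s : Fin m → X // m * t ≤ ∑ i, φ (s i)} : ℝ) * Real.exp (c * (m * t)) ≤
      ∑ s : Fin m → X, Real.exp (c * ∑ i, φ (s i)) := by
    rw [Nat.card_eq_fintype_card, Fintype.card_subtype, ← nsmul_eq_mul, ← Finset.sum_const]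
    refine (Finset.sum_le_sum fun s hs => ?_).trans
      (Finset.sum_le_univ_sum_of_nonneg fun _ => (Real.exp_pos _).le)
    rw [Finset.mem_filter] at hs
    gcongr
    exact hs.2
  have h4 := h3.trans h2
  rw [← le_div_iff₀ (Real.exp_pos _), mul_div_assoc, ← Real.exp_sub] at h4
  refine h4.trans (le_of_eq ?_)
  congr 2
  rw [hc]
  ring

/-- The algorithm that queries `m` uniform independent points and applies `V` to the points and
the answers. -/
noncomputable def uniformSampler {X Y : Type} [Fintype X] [Nonempty X] (m : ℕ)
    (V : (Fin m → X) → (Fin m → Y) → Bool) : RandNonadaptiveAlg X Y :=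
  (PMF.uniformOfFintype (Fin m → X)).map fun s => ⟨m, s, V s⟩

lemma numQueries_of_mem_support_uniformSampler {X Y : Type} [Fintype X] [Nonempty X] (m : ℕ)
    (V : (Fin m → X) → (Fin m → Y) → Bool) (A : NonadaptiveAlg X Y)
    (hA : A ∈ (uniformSampler m V).support) : A.numQueries = m := by
  rw [uniformSampler, PMF.mem_support_map_iff] at hA
  obtain ⟨s, -, rfl⟩ := hA
  rfl

lemma two_thirds_le_probOutput {X Y : Type} [Fintype X] [Nonempty X] (m : ℕ)
    (V : (Fin m → X) → (Fin m → Y) → Bool) (f : X → Y) (b : Bool) (bad : Set (Fin m → X))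
    (hbad : (Nat.card bad : ℝ) ≤ (Fintype.card X : ℝ) ^ m / 3)
    (hgood : ∀ s, s ∉ bad → V s (fun i => f (s i)) = b) :
    2 / 3 ≤ (uniformSampler m V).probOutput f b := by
  classical
  rw [RandNonadaptiveAlg.probOutput, uniformSampler, PMF.map_comp, PMF.map_apply]
  simp only [PMF.uniformOfFintype_apply, Function.comp_def, NonadaptiveAlg.run]
  rw [tsum_fintype, ← Finset.sum_filter, Finset.sum_const, nsmul_eq_mul]
  have hsub : badᶜ.toFinset ⊆ Finset.univ.filter fun s => b = V s fun i => f (s i) := by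
    intro s hs
    simp only [Set.mem_toFinset, Set.mem_compl_iff] at hs
    simp [hgood s hs]
  have hcard : (2 / 3 : ℝ) * (Fintype.card (Fin m → X)) ≤
      (Finset.univ.filter fun s => b = V s fun i => f (s i)).card := by
    have h1 : ((badᶜ.toFinset).card : ℝ) ≤
        (Finset.univ.filter fun s => b = V s fun i => f (s i)).card := by
      exact_mod_cast Finset.card_le_card hsub
    have h2 : (badᶜ.toFinset).card + bad.toFinset.card = Fintype.card (Fin m → X) := by
      rw [Set.toFinset_compl, Finset.card_compl_add_card]
    have h3 : Nat.card bad = bad.toFinset.card := by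
      rw [Nat.card_eq_fintype_card, Set.toFinset_card]
    rw [h3] at hbad
    have h4 : ((badᶜ.toFinset).card : ℝ) + bad.toFinset.card = Fintype.card (Fin m → X) := by
      exact_mod_cast h2
    have h5 : ((Fintype.card (Fin m → X) : ℕ) : ℝ) = (Fintype.card X : ℝ) ^ m := by simp
    rw [h5] at h4 ⊢
    linarith
  rw [← div_eq_mul_inv, ENNReal.le_div_iff_mul_le (by simp) (by simp)]
  have h23 : (2 / 3 : ℝ≥0∞) = ENNReal.ofReal (2 / 3) := by
    rw [ENNReal.ofReal_div_of_pos (by norm_num)]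
    norm_num
  rw [h23, ← ENNReal.ofReal_natCast, ← ENNReal.ofReal_natCast,
    ← ENNReal.ofReal_mul (by norm_num)]
  exact ENNReal.ofReal_le_ofReal hcard

lemma l1Dist_nonneg {X : Type} [Fintype X] (f g : X → I) : 0 ≤ l1Dist f g :=
  div_nonneg (Finset.sum_nonneg fun _ _ => abs_nonneg _) (Nat.cast_nonneg _)

lemma l1DistTo_le {X : Type} [Fintype X] (f : X → I) {P : Set (X → I)} {g : X → I}
    (hg : g ∈ P) : l1DistTo f P ≤ l1Dist f g :=
  csInf_le ⟨0, by rintro _ ⟨h, -, rfl⟩; exact l1Dist_nonneg f h⟩ ⟨g, hg, rfl⟩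

/-- The sign `w` selects the upper or lower tail. -/
lemma card_l1_deviation_le {X : Type} [Fintype X] [Nonempty X] (f g : X → I) (w : ℝ)
    (hw : |w| = 1) (m : ℕ) {t : ℝ} (ht0 : 0 ≤ t) (ht : t ≤ 1) :
    (Nat.card {s : Fin m → X // m * t ≤
      w * (∑ i, |(f (s i) : ℝ) - g (s i)| - m * l1Dist f g)} : ℝ) ≤
      (Fintype.card X : ℝ) ^ m * Real.exp (-(t ^ 2 / 4 * m)) := by
  have hX : (0 : ℝ) < Fintype.card X := by exact_mod_cast Fintype.card_pos
  have hpt : ∀ x, |(f x : ℝ) - g x| ≤ 1 := fun x => by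
    rw [abs_le]
    constructor <;> linarith [(f x).2.1, (f x).2.2, (g x).2.1, (g x).2.2]
  have hD : l1Dist f g ≤ 1 := by
    rw [l1Dist, div_le_one hX]
    exact (Finset.sum_le_sum fun x _ => hpt x).trans (by simp)
  have h := card_deviation_le (fun x => w * (|(f x : ℝ) - g x| - l1Dist f g)) (fun x => by
      rw [abs_mul, hw, one_mul, abs_le]
      constructor <;> linarith [hpt x, abs_nonneg ((f x : ℝ) - g x), l1Dist_nonneg f g]) (by
      rw [← Finset.mul_sum, Finset.sum_sub_distrib]
      simp only [Finset.sum_const, Finset.card_univ, nsmul_eq_mul]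
      rw [l1Dist, mul_div_cancel₀ _ hX.ne', sub_self, mul_zero]) m ht0 ht
  simpa [← Finset.mul_sum, Finset.sum_sub_distrib] using h

/-- A property with a finite cover has a tolerant tester whose number of queries is logarithmic
in the size of the cover. -/
lemma exists_tester_of_cover {X Θ : Type} [Fintype X] [Nonempty X] [Finite Θ] (P : Set (X → I))
    (hP : P.Nonempty) (p : Θ → X → ℝ) {ε₁ ε₂ e : ℝ} (he : 0 < e) (he1 : e ≤ 1)
    (hε : ε₁ + e ≤ ε₂)
    (hcov : ∀ g ∈ P, ∃ θ, ∑ x, |(g x : ℝ) - p θ x| ≤ 5 / 16 * e * Fintype.card X)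
    (m : ℕ) (hm0 : 0 < m) (hm : Real.log (3 * Nat.card Θ) ≤ e ^ 2 / 256 * m) :
    ∃ T : RandNonadaptiveAlg X I, (∀ A ∈ T.support, A.numQueries ≤ m) ∧
      ∀ f : X → I, (l1DistTo f P ≤ ε₁ → 2 / 3 ≤ T.probOutput f true) ∧
        (ε₂ ≤ l1DistTo f P → 2 / 3 ≤ T.probOutput f false) := by
  classical
  have := Fintype.ofFinite Θ
  have hX : (0 : ℝ) < Fintype.card X := by exact_mod_cast Fintype.card_pos
  have hm0' : (0 : ℝ) < m := by exact_mod_cast hm0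
  -- a finite net inside `P`
  have hnet : ∀ θ, ∃ g ∈ P, ∀ h ∈ P, ∑ x, |(h x : ℝ) - p θ x| ≤ 5 / 16 * e * Fintype.card X →
      l1Dist h g ≤ 5 / 8 * e := by
    intro θ
    by_cases hex : ∃ g ∈ P, ∑ x, |(g x : ℝ) - p θ x| ≤ 5 / 16 * e * Fintype.card X
    · obtain ⟨g, hg, hgp⟩ := hex
      refine ⟨g, hg, fun h _ hhp => ?_⟩
      rw [l1Dist, div_le_iff₀ hX]
      calc _ ≤ ∑ x, (|(h x : ℝ) - p θ x| + |(g x : ℝ) - p θ x|) :=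
            Finset.sum_le_sum fun x _ => by
              rw [abs_sub_comm (g x : ℝ)]
              exact abs_sub_le _ _ _
        _ ≤ _ := by
            rw [Finset.sum_add_distrib]
            linarith
    · obtain ⟨g, hg⟩ := hP
      exact ⟨g, hg, fun h hh hhp => absurd ⟨h, hh, hhp⟩ hex⟩
  choose G hGP hG using hnet
  obtain ⟨g₀, hg₀⟩ := hP
  obtain ⟨θ₀, -⟩ := hcov g₀ hg₀
  have hcardpos : (1 : ℝ) ≤ Nat.card Θ := by
    have : Nonempty Θ := ⟨θ₀⟩
    exact_mod_cast Nat.card_pos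
  -- Each representative fails with probability at most `1 / (3 |Θ|)`, which leaves `1 / 3` after
  -- the union bound.
  have hexp : Real.exp (-((e / 8) ^ 2 / 4 * m)) ≤ 1 / (3 * Nat.card Θ) := by
    rw [Real.exp_neg, one_div]
    refine inv_anti₀ (by positivity) ?_
    rw [← Real.log_le_iff_le_exp (by positivity)]
    refine hm.trans (le_of_eq ?_)
    ring
  -- In units of `e / 16` above `ε₁`: a near-optimal monotone function costs 1, its representative
  -- 10, sampling 2, so close inputs stay below the threshold 13. Far inputs are at distance at
  -- least 16 from every representative, since these lie in `P`, and sampling leaves more than 14.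
  let V : (Fin m → X) → (Fin m → I) → Bool := fun s y =>
    decide (∃ θ, ∑ i, |(y i : ℝ) - G θ (s i)| ≤ m * (ε₁ + 13 / 16 * e))
  refine ⟨uniformSampler m V,
    fun A hA => (numQueries_of_mem_support_uniformSampler m V A hA).le, fun f => ⟨?_, ?_⟩⟩
  · intro hf
    obtain ⟨_, ⟨g, hg, rfl⟩, hfg⟩ := exists_lt_of_csInf_lt (Set.Nonempty.image _ ⟨g₀, hg₀⟩)
      (lt_of_le_of_lt hf (show ε₁ < ε₁ + e / 16 by linarith))
    obtain ⟨θ, hθ⟩ := hcov g hg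
    have hfG : l1Dist f (G θ) ≤ ε₁ + 11 / 16 * e := by
      have h1 := hG θ g hg hθ
      have h2 : l1Dist f (G θ) ≤ l1Dist f g + l1Dist g (G θ) := by
        rw [l1Dist, l1Dist, l1Dist, ← add_div, ← Finset.sum_add_distrib]
        gcongr
        exact abs_sub_le _ _ _
      linarith
    refine two_thirds_le_probOutput m V f true
      {s | m * (e / 8) ≤ 1 * (∑ i, |(f (s i) : ℝ) - G θ (s i)| - m * l1Dist f (G θ))} ?_ ?_
    · refine (card_l1_deviation_le f (G θ) 1 (by simp) m (by positivity) (by linarith)).trans ?_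
      rw [div_eq_mul_one_div (_ ^ m)]
      refine mul_le_mul_of_nonneg_left (hexp.trans ?_) (by positivity)
      exact one_div_le_one_div_of_le (by norm_num) (by linarith)
    · intro s hs
      simp only [Set.mem_ofPred_eq, not_le, one_mul] at hs
      refine decide_eq_true ⟨θ, ?_⟩
      nlinarith
  · intro hf
    refine two_thirds_le_probOutput m V f false
      (⋃ θ, {s | m * (e / 8) ≤ -1 * (∑ i, |(f (s i) : ℝ) - G θ (s i)| - m * l1Dist f (G θ))})
      ?_ ?_
    · have hU := Finset.card_biUnion_le (s := (Finset.univ : Finset Θ)) (t := fun θ =>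
        Finset.univ.filter fun s : Fin m → X =>
          m * (e / 8) ≤ -1 * (∑ i, |(f (s i) : ℝ) - G θ (s i)| - m * l1Dist f (G θ)))
      have hc : Nat.card (⋃ θ, {s : Fin m → X |
          m * (e / 8) ≤ -1 * (∑ i, |(f (s i) : ℝ) - G θ (s i)| - m * l1Dist f (G θ))}) ≤
          ∑ θ : Θ, Nat.card {s : Fin m → X //
            m * (e / 8) ≤ -1 * (∑ i, |(f (s i) : ℝ) - G θ (s i)| - m * l1Dist f (G θ))} := by
        refine le_trans (le_of_eq ?_) (hU.trans (le_of_eq ?_))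
        · rw [Nat.card_eq_fintype_card, ← Set.toFinset_card]
          congr 1
          ext s
          simp
        · refine Finset.sum_congr rfl fun θ _ => ?_
          rw [Nat.card_eq_fintype_card, Fintype.card_subtype]
      calc _ ≤ ((∑ θ : Θ, Nat.card {s : Fin m → X //
            m * (e / 8) ≤ -1 * (∑ i, |(f (s i) : ℝ) - G θ (s i)| - m * l1Dist f (G θ))} : ℕ) : ℝ) := by
            exact_mod_cast hc
        _ ≤ ∑ _θ : Θ, (Fintype.card X : ℝ) ^ m * (1 / (3 * Nat.card Θ)) := by
            push_cast
            refine Finset.sum_le_sum fun θ _ => ?_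
            refine (card_l1_deviation_le f (G θ) (-1) (by simp) m (by positivity)
              (by linarith)).trans ?_
            gcongr
        _ = _ := by
            rw [Finset.sum_const, Finset.card_univ, ← Nat.card_eq_fintype_card, nsmul_eq_mul]
            field_simp
    · intro s hs
      simp only [Set.mem_iUnion, Set.mem_ofPred_eq, not_exists, not_le] at hs
      refine decide_eq_false ?_
      rintro ⟨θ, hθ⟩
      have h1 := hs θ
      have h2 := l1DistTo_le f (hGP θ)
      have h3 : (m : ℝ) * (ε₁ + e) ≤ m * l1Dist f (G θ) := by gcongr; linarith
      nlinarith
end Sampling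

/-! ### Choice of parameters and the two query bounds -/

section QueryBounds

/-- There is a tolerant monotonicity tester on `[n]^d` that makes at most `m` queries. -/
def HasMonotonicityTester (n d : ℕ) (ε₁ ε₂ : ℝ) (m : ℕ) : Prop :=
  ∃ T : RandNonadaptiveAlg (Fin d → Fin n) I, (∀ A ∈ T.support, A.numQueries ≤ m) ∧
    ∀ f : (Fin d → Fin n) → I,
      (l1DistTo f {f | Monotone f} ≤ ε₁ → 2 / 3 ≤ T.probOutput f true) ∧
      (ε₂ ≤ l1DistTo f {f | Monotone f} → 2 / 3 ≤ T.probOutput f false)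

lemma hasMonotonicityTester_of_cover {n d : ℕ} {Θ : Type} [Finite Θ] (hn : 0 < n)
    (p : Θ → (Fin d → Fin n) → ℝ) {ε₁ ε₂ e δ : ℝ} (he : 0 < e) (he1 : e ≤ 1)
    (hε : ε₁ + e ≤ ε₂) (hδ : δ ≤ 5 / 16 * e)
    (hcov : ∀ f : (Fin d → Fin n) → ℝ, Monotone f → (∀ x, 0 ≤ f x) → (∀ x, f x ≤ 1) →
      ∃ θ, ∑ x, |f x - p θ x| ≤ δ * (n : ℝ) ^ d)
    (m : ℕ) (hm0 : 0 < m) (hm : Real.log (3 * Nat.card Θ) ≤ e ^ 2 / 256 * m) :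
    HasMonotonicityTester n d ε₁ ε₂ m := by
  have : Nonempty (Fin n) := ⟨⟨0, hn⟩⟩
  refine exists_tester_of_cover {f : (Fin d → Fin n) → I | Monotone f} ⟨fun _ => 0, monotone_const⟩
    p he he1 hε (fun g hg => ?_) m hm0 hm
  obtain ⟨θ, hθ⟩ := hcov (fun x => g x) (fun x y hxy => hg hxy) (fun x => (g x).2.1)
    (fun x => (g x).2.2)
  refine ⟨θ, hθ.trans ?_⟩
  simp only [Fintype.card_fun, Fintype.card_fin, Nat.cast_pow]
  gcongr

lemma exists_queries_of_log_le {e B L : ℝ} (he : 0 < e) (hB : 0 ≤ B) (hL : L ≤ B) :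
    ∃ m : ℕ, 0 < m ∧ L ≤ e ^ 2 / 256 * m ∧ (m : ℝ) ≤ 256 / e ^ 2 * B + 2 := by
  have h0 : 0 ≤ 256 / e ^ 2 * B := by positivity
  refine ⟨⌈256 / e ^ 2 * B⌉₊ + 1, Nat.succ_pos _, ?_, ?_⟩
  · refine hL.trans ?_
    have h : 256 / e ^ 2 * B ≤ ((⌈256 / e ^ 2 * B⌉₊ + 1 : ℕ) : ℝ) := by
      push_cast
      linarith [Nat.le_ceil (256 / e ^ 2 * B)]
    calc B = e ^ 2 / 256 * (256 / e ^ 2 * B) := by field_simp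
      _ ≤ _ := by gcongr
  · push_cast
    linarith [Nat.ceil_lt_add_one h0]

lemma log_le_logb_two {y : ℝ} (hy : 1 ≤ y) : Real.log y ≤ Real.logb 2 y := by
  rw [Real.logb, le_div_iff₀ (Real.log_pos (by norm_num))]
  have h1 := Real.log_nonneg hy
  have h2 := Real.log_two_lt_d9
  nlinarith

lemma log_mul_pow_card_le (N s : ℕ) :
    Real.log (3 * ((s + 1) ^ N : ℕ)) ≤ 2 + N * Real.log (s + 1) := by
  push_cast
  rw [Real.log_mul (by norm_num) (by positivity), Real.log_pow]
  have : Real.log 3 ≤ 2 := by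
    have := Real.log_le_sub_one_of_pos (show (0 : ℝ) < 3 by norm_num)
    linarith
  linarith

lemma exists_tester_block_bound (n d : ℕ) (ε₁ ε₂ : ℝ) (hn : 1 ≤ n) (hd : 1 ≤ d) (h0 : 0 ≤ ε₁)
    (h12 : ε₁ < ε₂) (h1 : ε₂ ≤ 1) :
    ∃ m : ℕ, HasMonotonicityTester n d ε₁ ε₂ m ∧
      (m : ℝ) ≤ softBound 1282 1 (1 / (ε₂ - ε₁) ^ 2 * (5 * (d : ℝ) / (ε₂ - ε₁)) ^ d) := by
  obtain ⟨e, he_def⟩ : ∃ e, e = ε₂ - ε₁ := ⟨_, rfl⟩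
  rw [← he_def]
  have he : 0 < e := by linarith
  have he1 : e ≤ 1 := by linarith
  have hd' : (1 : ℝ) ≤ d := by exact_mod_cast hd
  have hr0 : (0 : ℝ) < 16 / e := by positivity
  set r := ⌈16 / e⌉₊ with hr_def
  have hr : 0 < r := Nat.ceil_pos.2 hr0
  have hr' : 16 / e ≤ r := Nat.le_ceil _
  have hrinv : (1 : ℝ) / r ≤ e / 16 := by
    rw [one_div_le (by exact_mod_cast hr) (by positivity)]
    simpa using hr'
  -- Block width `e / 4` gives `4 * d / e + 1 ≤ 5 * d / e` blocks per side, the source of the base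
  -- `5 * d / e`. With `1 / r ≤ e / 16` the total error is `5 / 16 * e`.
  obtain ⟨k, hk, p, hp⟩ := exists_block_cover hn hd (show 0 < e / 4 by positivity) r hr
  have he_inv : 1 ≤ 1 / e := by rw [le_div_iff₀ he]; linarith
  have hde : 1 / e ≤ d / e := by gcongr
  have hk' : (k : ℝ) ≤ 5 * d / e := by
    refine hk.trans ?_
    have e1 : (d : ℝ) / (e / 4) = 4 * (d / e) := by field_simp
    have e2 : 5 * (d : ℝ) / e = 5 * (d / e) := by ring
    rw [e1, e2]
    linarith
  set K : ℝ := (5 * (d : ℝ) / e) ^ d with hK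
  have hbase : 5 * (1 / e) ≤ 5 * (d : ℝ) / e := by
    rw [mul_div_assoc]; linarith
  have hKe : 5 * (1 / e) ≤ K :=
    hbase.trans (le_self_pow₀ (by linarith) (by omega))
  have hK1 : 1 ≤ K := by linarith
  have hkK : ((k ^ d : ℕ) : ℝ) ≤ K := by
    push_cast
    exact pow_le_pow_left₀ (Nat.cast_nonneg _) hk' d
  set x : ℝ := 1 / e ^ 2 * K with hx
  have hKx : K ≤ x := by
    have : 1 ≤ 1 / e ^ 2 := by
      rw [le_div_iff₀ (by positivity)]
      nlinarith
    nlinarith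
  set ℓ := Real.logb 2 (x + 2) with hℓ
  have hℓ1 : 1 ≤ ℓ := by
    rw [hℓ, Real.le_logb_iff_rpow_le (by norm_num) (by linarith)]
    norm_num
    linarith
  have hlogr : Real.log (r + 1) ≤ 3 * ℓ := by
    have h2 : (r : ℝ) + 1 ≤ 2 ^ 2 * (x + 2) := by
      have : (r : ℝ) ≤ 16 * (1 / e) + 1 := by
        rw [mul_one_div]
        exact (Nat.ceil_lt_add_one hr0.le).le
      linarith
    calc Real.log (r + 1) ≤ Real.log (2 ^ 2 * (x + 2)) := Real.log_le_log (by positivity) h2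
      _ ≤ Real.logb 2 (2 ^ 2 * (x + 2)) := log_le_logb_two (by linarith)
      _ = 2 + ℓ := by
        rw [Real.logb_mul (by norm_num) (by linarith), Real.logb_pow]
        simp [hℓ]
      _ ≤ 3 * ℓ := by linarith
  have hL : Real.log (3 * Nat.card ((Fin d → Fin k) → Fin (r + 1))) ≤ 5 * K * ℓ := by
    have hc : Nat.card ((Fin d → Fin k) → Fin (r + 1)) = (r + 1) ^ (k ^ d) := by simp
    rw [hc]
    refine (log_mul_pow_card_le _ _).trans ?_
    have : ((k ^ d : ℕ) : ℝ) * Real.log (r + 1) ≤ K * (3 * ℓ) :=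
      mul_le_mul hkK hlogr (Real.log_nonneg (by simp)) (by linarith)
    nlinarith
  obtain ⟨m, hm0, hm, hmB⟩ := exists_queries_of_log_le he (by positivity) hL
  refine ⟨m, hasMonotonicityTester_of_cover hn p he he1 (by linarith) (by linarith) hp m hm0 hm, ?_⟩
  refine hmB.trans ?_
  rw [softBound, pow_one]
  have : 256 / e ^ 2 * (5 * K * ℓ) = 1280 * x * ℓ := by rw [hx]; ring
  rw [this]
  nlinarith

/-- The number of patterns, at most `(d * k + 1) ^ D`, dominates. The factor `3 ^ d` in `r` enters
only through `log (r + 1)`, which is linear in `d` and in `log (1 / e)`. -/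
lemma log_card_sparse_cover_le {d k D r : ℕ} {e Y : ℝ} (hd : 1 ≤ d) (he : 0 < e) (hY : 3 ≤ Y)
    (hdY : (d : ℝ) ≤ Y ^ 2) (heY : 1 / e ≤ Y) (hk : (k : ℝ) ≤ 17 * (d * (1 / e)))
    (hr : (r : ℝ) + 1 ≤ 18 * 3 ^ d * (1 / e)) :
    Real.log (3 * Nat.card (SparsePattern (Fin d) (Fin k) D → Fin (r + 1))) ≤
      2 * Y ^ (8 * D + 4) := by
  have hd' : (1 : ℝ) ≤ d := by exact_mod_cast hd
  have hY0 : 0 ≤ Y := by linarith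
  have hc : Nat.card (SparsePattern (Fin d) (Fin k) D → Fin (r + 1)) =
      (r + 1) ^ Nat.card (SparsePattern (Fin d) (Fin k) D) := by
    rw [Nat.card_fun]; simp
  rw [hc]
  refine (log_mul_pow_card_le _ _).trans ?_
  have hJ : (Nat.card (SparsePattern (Fin d) (Fin k) D) : ℝ) ≤ Y ^ (8 * D) := by
    have h1 : (Nat.card (SparsePattern (Fin d) (Fin k) D) : ℝ) ≤ ((d : ℝ) * k + 1) ^ D := by
      have := card_sparsePattern_le (Fin d) (Fin k) D
      simp only [Fintype.card_fin] at this
      exact_mod_cast this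
    refine h1.trans ?_
    rw [pow_mul]
    refine pow_le_pow_left₀ (by positivity) ?_ D
    have h2 : (d : ℝ) * k ≤ Y ^ 2 * (17 * (Y ^ 2 * Y)) := by
      refine mul_le_mul hdY (hk.trans ?_) (Nat.cast_nonneg _) (by positivity)
      gcongr
    have h3 : (27 : ℝ) ≤ Y ^ 3 := by
      calc (27 : ℝ) = 3 ^ 3 := by norm_num
        _ ≤ Y ^ 3 := by gcongr
    have h4 : (1 : ℝ) ≤ Y ^ 5 := one_le_pow₀ (by linarith)
    calc (d : ℝ) * k + 1 ≤ 18 * Y ^ 5 := by linarith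
      _ ≤ Y ^ 3 * Y ^ 5 := by gcongr; linarith
      _ = Y ^ 8 := by ring
  have hlog : Real.log (r + 1) ≤ Y ^ 4 := by
    have h1 : Real.log (r + 1) ≤ Real.log (18 * 3 ^ d * (1 / e)) :=
      Real.log_le_log (by positivity) hr
    rw [Real.log_mul (by positivity) (by positivity), Real.log_mul (by positivity) (by positivity),
      Real.log_pow] at h1
    have a1 := Real.log_le_sub_one_of_pos (show (0 : ℝ) < 18 by norm_num)
    have a2 := Real.log_le_sub_one_of_pos (show (0 : ℝ) < 3 by norm_num)
    have a3 := Real.log_le_sub_one_of_pos (show 0 < 1 / e by positivity)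
    have a4 : d * Real.log 3 ≤ Y ^ 2 * 2 := by
      refine mul_le_mul hdY (by linarith) (Real.log_nonneg (by norm_num)) (by positivity)
    nlinarith [sq_nonneg (Y ^ 2 - 9)]
  have h5 : (Nat.card (SparsePattern (Fin d) (Fin k) D) : ℝ) * Real.log (r + 1) ≤
      Y ^ (8 * D) * Y ^ 4 := by
    refine mul_le_mul hJ hlog (Real.log_nonneg ?_) (by positivity)
    linarith [(Nat.cast_nonneg r : (0 : ℝ) ≤ r)]
  have h6 : (2 : ℝ) ≤ Y ^ (8 * D + 4) :=
    le_trans (by linarith) (le_self_pow₀ (show 1 ≤ Y by linarith) (by omega))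
  rw [← pow_add] at h5
  linarith

/-- The gap used is `ε₂ - 3 * ε₁`, which is at most `ε₂ - ε₁`, so the same cover-based tester
applies. -/
lemma exists_tester_lowPart_bound (n d : ℕ) (ε₁ ε₂ : ℝ) (hn : 1 ≤ n) (hd : 1 ≤ d)
    (h0 : 0 ≤ 3 * ε₁) (h12 : 3 * ε₁ < ε₂) (h1 : ε₂ ≤ 1) :
    ∃ m : ℕ, HasMonotonicityTester n d ε₁ ε₂ m ∧
      (m : ℝ) ≤ (2 : ℝ) ^ softBound 2068 1 (Real.sqrt (d : ℝ) / (ε₂ - 3 * ε₁) ^ 2) := by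
  obtain ⟨e, he_def⟩ : ∃ e, e = ε₂ - 3 * ε₁ := ⟨_, rfl⟩
  rw [← he_def]
  have he : 0 < e := by linarith
  have he1 : e ≤ 1 := by linarith
  have hd' : (1 : ℝ) ≤ d := by exact_mod_cast hd
  have he_inv : 1 ≤ 1 / e := by rw [le_div_iff₀ he]; linarith
  have he2 : 1 / e ≤ 1 / e ^ 2 := by
    gcongr
    nlinarith
  set y := Real.sqrt d / e ^ 2 with hy
  have hsq : 1 ≤ Real.sqrt d := Real.one_le_sqrt.2 hd'
  have hy2 : 1 / e ^ 2 ≤ y := by rw [hy]; gcongr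
  have hsy : Real.sqrt d ≤ y := by
    rw [hy, le_div_iff₀ (by positivity)]
    nlinarith [mul_le_mul he1 he1 he.le zero_le_one]
  have hdy : (d : ℝ) ≤ y ^ 2 := by
    rw [← Real.sq_sqrt (Nat.cast_nonneg d)]
    gcongr
  have hy1 : 1 ≤ y := by linarith
  -- Chosen so that `√d ≤ D * (e / 16) ^ 2`, making the truncation error at most `e / 16`.
  set D := ⌈256 * y⌉₊ with hD
  have hDpos : 0 < D := Nat.ceil_pos.2 (by linarith)
  have hD' : 256 * y ≤ D := Nat.le_ceil _
  have hDle : (D : ℝ) ≤ 256 * y + 1 := (Nat.ceil_lt_add_one (by linarith)).le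
  have hDe : Real.sqrt d ≤ D * (e / 16) ^ 2 := by
    calc Real.sqrt d = 256 * y * (e / 16) ^ 2 := by rw [hy]; field_simp; norm_num
      _ ≤ _ := by gcongr
  have hr0 : (0 : ℝ) < 16 * 3 ^ d * (1 / e) := by positivity
  set r := ⌈16 * 3 ^ d * (1 / e)⌉₊ with hr_def
  have hr : 0 < r := Nat.ceil_pos.2 hr0
  have hr' : 16 * 3 ^ d * (1 / e) ≤ r := Nat.le_ceil _
  have hrR : (0 : ℝ) < r := by exact_mod_cast hr
  have hrinv : 3 ^ d * (1 / (r : ℝ)) ≤ e / 16 := by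
    rw [mul_one_div, div_le_iff₀ hrR]
    calc (3 : ℝ) ^ d = e / 16 * (16 * 3 ^ d * (1 / e)) := by field_simp
      _ ≤ _ := by gcongr
  obtain ⟨k, hk, p, hp⟩ := exists_lowPart_cover (n := n) hn hd (show 0 < e / 16 by positivity)
    (show 0 ≤ e / 16 by positivity) D hDpos hDe r hr
  set Y := y + 2 with hYdef
  have hY : 3 ≤ Y := by linarith
  have hL := log_card_sparse_cover_le (D := D) (k := k) (r := r) hd he hY
    (hdy.trans (by gcongr; linarith)) (by linarith) (by
      refine hk.trans ?_
      have e1 : (d : ℝ) / (e / 16) = 16 * (d * (1 / e)) := by field_simp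
      rw [e1]
      nlinarith) (by
      have h3 : (1 : ℝ) ≤ 3 ^ d := one_le_pow₀ (by norm_num)
      have h4 := (Nat.ceil_lt_add_one hr0.le).le
      rw [← hr_def] at h4
      nlinarith)
  obtain ⟨m, hm0, hm, hmB⟩ := exists_queries_of_log_le he (by positivity) hL
  refine ⟨m, hasMonotonicityTester_of_cover hn p he he1 (by linarith) (by linarith) hp m hm0 hm, ?_⟩
  have hpow : (m : ℝ) ≤ Y ^ (8 * D + 12) := by
    have h7 : 256 / e ^ 2 ≤ 256 * Y := by
      rw [← mul_one_div]; linarith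
    have h8 : (256 : ℝ) ≤ Y ^ 6 := by
      calc (256 : ℝ) ≤ 3 ^ 6 := by norm_num
        _ ≤ Y ^ 6 := by gcongr
    have h9 : (2 : ℝ) ≤ Y ^ (8 * D + 11) :=
      le_trans (by linarith) (le_self_pow₀ (show 1 ≤ Y by linarith) (by omega))
    calc (m : ℝ) ≤ 256 / e ^ 2 * (2 * Y ^ (8 * D + 4)) + 2 := hmB
      _ ≤ (Y ^ 6 * Y) * (2 * Y ^ (8 * D + 4)) + 2 := by
        gcongr
        exact h7.trans (by gcongr)
      _ = 2 * Y ^ (8 * D + 11) + 2 := by ring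
      _ ≤ 3 * Y ^ (8 * D + 11) := by linarith
      _ ≤ Y * Y ^ (8 * D + 11) := by gcongr
      _ = Y ^ (8 * D + 12) := by ring
  refine hpow.trans ?_
  have hYpos : 0 < Y := by linarith
  have hlogY : 0 ≤ Real.logb 2 Y := Real.logb_nonneg (by norm_num) (by linarith)
  have hrep : Y ^ (8 * D + 12) = (2 : ℝ) ^ (Real.logb 2 Y * ((8 * D + 12 : ℕ) : ℝ)) := by
    rw [Real.rpow_mul (by norm_num), Real.rpow_logb (by norm_num) (by norm_num) hYpos,
      Real.rpow_natCast]
  rw [hrep, softBound, pow_one]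
  refine Real.rpow_le_rpow_of_exponent_le (by norm_num) ?_
  rw [mul_comm]
  gcongr
  -- From `D ≤ 256 * y + 1` and `1 ≤ y`: `8 * D + 12 ≤ 2048 * y + 20 ≤ 2068 * y`.
  push_cast
  linarith

end QueryBounds

theorem mainTheorem2 :
    ∃ (T : (n d : ℕ) → ℝ → ℝ → RandNonadaptiveAlg (Fin d → Fin n) unitInterval)
      (q : ℕ → ℕ → ℝ → ℝ → ℕ),
      (∀ n d : ℕ, 1 ≤ n → 1 ≤ d →
        IsTolerantL1Tester {f : (Fin d → Fin n) → unitInterval | Monotone f} (q n d) (T n d)) ∧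
      (∃ (C : ℝ) (c : ℕ), ∀ (n d : ℕ) (ε₁ ε₂ : ℝ), 1 ≤ n → 1 ≤ d →
        0 ≤ ε₁ → ε₁ < ε₂ → ε₂ ≤ 1 →
          (q n d ε₁ ε₂ : ℝ) ≤
            softBound C c (1 / (ε₂ - ε₁) ^ 2 * (5 * (d : ℝ) / (ε₂ - ε₁)) ^ d)) ∧
      (∃ (C : ℝ) (c : ℕ), ∀ (n d : ℕ) (ε₁ ε₂ : ℝ), 1 ≤ n → 1 ≤ d →
        0 ≤ 3 * ε₁ → 3 * ε₁ < ε₂ → ε₂ ≤ 1 →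
          (q n d ε₁ ε₂ : ℝ) ≤
            (2 : ℝ) ^ softBound C c (Real.sqrt (d : ℝ) / (ε₂ - 3 * ε₁) ^ 2)) := by
  classical
  -- Taking the least achievable query count makes one tester satisfy both bounds at once, without
  -- comparing them.
  let q : ℕ → ℕ → ℝ → ℝ → ℕ := fun n d ε₁ ε₂ => sInf {m | HasMonotonicityTester n d ε₁ ε₂ m}
  have hq : ∀ (n d : ℕ) (ε₁ ε₂ : ℝ) (m : ℕ), HasMonotonicityTester n d ε₁ ε₂ m →
      (q n d ε₁ ε₂ : ℝ) ≤ m := fun n d ε₁ ε₂ m hm => by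
    exact_mod_cast Nat.sInf_le hm
  refine ⟨fun n d ε₁ ε₂ => if h : HasMonotonicityTester n d ε₁ ε₂ (q n d ε₁ ε₂) then h.choose
    else PMF.pure ⟨0, Fin.elim0, fun _ => true⟩, q, ?_, ⟨1282, 1, ?_⟩, ⟨2068, 1, ?_⟩⟩
  · intro n d hn hd ε₁ ε₂ h0 h12 h1
    obtain ⟨m, hm, -⟩ := exists_tester_block_bound n d ε₁ ε₂ hn hd h0 h12 h1
    have h : HasMonotonicityTester n d ε₁ ε₂ (q n d ε₁ ε₂) :=
      Nat.sInf_mem (s := {m | HasMonotonicityTester n d ε₁ ε₂ m}) ⟨m, hm⟩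
    simp only [dif_pos h]
    exact h.choose_spec
  · intro n d ε₁ ε₂ hn hd h0 h12 h1
    obtain ⟨m, hm, hmle⟩ := exists_tester_block_bound n d ε₁ ε₂ hn hd h0 h12 h1
    exact (hq _ _ _ _ m hm).trans hmle
  · intro n d ε₁ ε₂ hn hd h0 h12 h1
    obtain ⟨m, hm, hmle⟩ := exists_tester_lowPart_bound n d ε₁ ε₂ hn hd h0 h12 h1
    exact (hq _ _ _ _ m hm).trans hmle
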